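/- **Setting.** Consider a feed-forward network on a finite directed acyclic graph, arranged in layers, with $d_x$ inputs, $d_y$ linear outputs and hidden units using ReLU and/or max pooling (a hidden unit is passed on unchanged if it is active, and replaced by $0$ otherwise). Index by $j$ the directed paths from the input units to the output layer, without their last unit, and let $d_z$ be their number. For network weights $w$ and an input $x\in\mathbb R^{d_x}$, let $\bar x_j$ be the input coordinate at which path $j$ starts and let $\bar\sigma_j(x,w)\in\{0,1\}$ be $1$ if and only if all hidden units of path $j$ are active in the network with weights $w$ on input $x$. For each output $k$ let $\bar w_{k}\in\mathbb R^{d_z}$ be a vector of path weights; for a network with weights $w$ its $j$-th entry is the product of the weights along path $j$ continued to output $k$ ($0$ if there is no such edge), and the $k$-th output is then $[\bar x\circ\bar\sigma(x,w)]^\top\bar w_k$. Let $P$ be a probability distribution on $\mathbb R^{d_x}\times\mathbb R^{d_y}$, let $m\ge1$, $\alpha\in(0,1)$ with $\alpha m$ an integer, let $S=((x_1,y_1),\dots,(x_m,y_m))$ be a random dataset, $S_{\alpha m}$ its first $\alpha m$ examples, and $m_\sigma=(1-\alpha)m$. Assume that the examples of $S\setminus S_{\alpha m}$ are i.i.d.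 with law $P$ and that $S\setminus S_{\alpha m}$ is independent of $S_{\alpha m}$. *Two-phase procedure.* A first phase learns network weights $w_\sigma$ from $S_{\alpha m}$; a second phase learns vectors $\bar w_1^S,\dots,\bar w_{d_y}^S$ from all of $S$. Both phases are arbitrary functions of their data. The final model is $f_{\mathcal A(S)}(x)_k=[\bar x\circ\bar\sigma(x,w_\sigma)]^\top\bar w_k^S$. For the squared loss let $\mathcal R[f]=\mathbb E_{(x,y)\sim P}\sum_k(f(x)_k-y_k)^2$ and $\mathcal R_{S\setminus S_{\alpha m}}[f]=\frac1{m_\sigma}\sum_{i=\alpha m+1}^m\sum_k(f(x_i)_k-y_{ik})^2$. *Boundedness and variance conditions (for a given $w_\sigma$).* Write $\tilde z=\bar x\circ\bar\sigma(x,w_\sigma)$ for $(x,y)\sim P$, and put $G=\mathbb E[\tilde z\tilde z^\top]-\tilde z\tilde z^\top$, $V_{kk'}=y_k\tilde z_{k'}-\mathbb E[y_k\tilde z_{k'}]$, $c_y=\mathbb E\|y\|_2^2-\|y\|_2^2$. The coordinates of $\tilde z$ have finite fourth moments (so that $\mathbb E[G^2]$ is finite), and, with $\|\cdot\|_2$ the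 spectral norm, - $\lambda_{\max}(G)\le C_{zz}$ almost surely and $\|\mathbb E[G^2]\|_2\le\gamma_{zz}^2$; - $\max_{k,k'}|V_{kk'}|\le C_{yz}$ almost surely and $\max_{k,k'}\mathbb E[V_{kk'}^2]\le\gamma_{yz}^2$; - $|c_y|\le C_y$ almost surely and $\mathbb E[c_y^2]\le\gamma_y^2$. **Theorem.** For almost every value of $S_{\alpha m}$, conditionally on that value (so that $w_\sigma$ is fixed and the probability is over $S\setminus S_{\alpha m}$), the following holds. For all constants $C_{zz},\gamma_{zz},C_{yz},\gamma_{yz},C_y,\gamma_y$ that satisfy the conditions above for $w_\sigma$, and for every $\delta>0$, with probability at least $1-\delta$, $$\mathcal R[f_{\mathcal A(S)}]-\mathcal R_{S\setminus S_{\alpha m}}[f_{\mathcal A(S)}]\le\beta_1\sum_{k=1}^{d_y}\|\bar w_k^S\|_2^2+2\beta_2\sum_{k=1}^{d_y}\|\bar w_k^S\|_1+\beta_3,$$ where $$\beta_1=\frac{2C_{zz}}{3m_\sigma}\ln\frac{3d_z}{\delta}+\sqrt{\frac{2\gamma_{zz}^2}{m_\sigma}\ln\frac{3d_z}{\delta}},\qquad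 \beta_2=\frac{2C_{yz}}{3m_\sigma}\ln\frac{6d_yd_z}{\delta}+\sqrt{\frac{2\gamma_{yz}^2}{m_\sigma}\ln\frac{6d_yd_z}{\delta}},\qquad \beta_3=\frac{2C_y}{3m_\sigma}\ln\frac3\delta+\sqrt{\frac{2\gamma_y^2}{m_\sigma}\ln\frac3\delta}.$$ (A square root of a negative number, which can occur only for large $\delta$, is read as $0$, and so is the logarithm of $0$, which occurs only if $d_z=0$ or $d_y=0$.) -/

import Mathlib

open MeasureTheory ProbabilityTheory

noncomputable section

/-- The architecture of a feed-forward network on a directed acyclic graph, organised in layers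
`0` (input), `1, …, depth` (hidden) and `depth + 1` (output), with arbitrary skip connections.
The edge relation says which entries of the weight matrices `W^{(l,l')}` are present.
In a hidden layer, the units with the same `pool` label compete in one max-pooling group
(a group with one unit does no pooling), and the units marked `relu` carry a ReLU. -/
structure Architecture where
  depth : ℕ
  width : Fin (depth + 2) → ℕ
  edge : (Σ l, Fin (width l)) → (Σ l, Fin (width l)) → Prop
  edge_lt : ∀ u v, edge u v → u.1 < v.1
  relu : (Σ l, Fin (width l)) → Prop
  pool : (Σ l, Fin (width l)) → ℕ

namespace Architecture

variable (N : Architecture)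

/-- The units of the network: a layer and an index in that layer. -/
abbrev Node : Type := Σ l, Fin (N.width l)

/-- Input dimension. -/
abbrev dx : ℕ := N.width 0

/-- Output dimension. -/
abbrev dy : ℕ := N.width (Fin.last (N.depth + 1))

abbrev inputNode (i : Fin N.dx) : N.Node := ⟨0, i⟩

abbrev outputNode (k : Fin N.dy) : N.Node := ⟨Fin.last (N.depth + 1), k⟩

/-- A labelled example `(x, y)`. -/
abbrev Example : Type := (Fin N.dx → ℝ) × (Fin N.dy → ℝ)

/-- An assignment of weights to the edges: `w u v` is the weight of the edge `u ⟶ v` (values at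
pairs that are not edges are never used). Structured weights, for instance shared ones, are
particular assignments. -/
abbrev Weights : Type := N.Node → N.Node → ℝ

open Classical in
/-- The 0-1 activation of unit `j` of layer `l` when the layer has the pre-activation vector `z`,
so that the nonlinearity of the layer is `z ↦ gate z ∘ z`. Inputs are passed on unchanged. A hidden
unit is active if it attains the maximum over its pooling group (ties are given to the smallest
index) and, when it carries a ReLU, its pre-activation is positive. -/
def gate (l : Fin (N.depth + 2)) (z : Fin (N.width l) → ℝ) (j : Fin (N.width l)) : ℝ :=
  if l = 0 then 1
  else if (N.relu ⟨l, j⟩ → 0 < z j) ∧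
      ∀ j', N.pool ⟨l, j'⟩ = N.pool ⟨l, j⟩ → z j' < z j ∨ (z j' = z j ∧ j ≤ j') then 1
  else 0

open Classical in
/-- The forward pass: `z^{[0]} = x`, and
`z^{[l]} = ∑_{l' < l} W^{(l,l')} σ^{[l']}(z^{[l']})` for `l > 0`. -/
def preact (w : N.Weights) (x : Fin N.dx → ℝ) : (l : Fin (N.depth + 2)) → Fin (N.width l) → ℝ
  | ⟨0, _⟩, i => x i
  | ⟨l + 1, hl⟩, j =>
      ∑ u : {u : N.Node // N.edge u ⟨⟨l + 1, hl⟩, j⟩},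
        w u.1 ⟨⟨l + 1, hl⟩, j⟩ *
          (N.gate u.1.1 (preact w x u.1.1) u.1.2 * preact w x u.1.1 u.1.2)
termination_by l => l.val
decreasing_by all_goals exact N.edge_lt _ _ u.2

/-- The activation `σ̇_u(x, w)` of a unit in the network with weights `w` on input `x`. -/
def activation (w : N.Weights) (x : Fin N.dx → ℝ) (u : N.Node) : ℝ :=
  N.gate u.1 (N.preact w x u.1) u.2

/-- The directed paths from an input unit to a given unit. -/
inductive PathTo : N.Node → Type
  | input (i : Fin N.dx) : PathTo (N.inputNode i)
  | step {u v : N.Node} (p : PathTo u) (e : N.edge u v) : PathTo v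

namespace PathTo

variable {N}

/-- `x̄`: the input used in the path. -/
def inputValue (x : Fin N.dx → ℝ) : {u : N.Node} → N.PathTo u → ℝ
  | _, input i => x i
  | _, step p _ => p.inputValue x

/-- `σ̄`: the product of the activations of the units of the path. -/
def activation (w : N.Weights) (x : Fin N.dx → ℝ) : {u : N.Node} → N.PathTo u → ℝ
  | _, input _ => 1
  | _, step (v := v) p _ => p.activation w x * N.activation w x v

/-- The product of the weights of the edges of the path. -/
def weight (w : N.Weights) : {u : N.Node} → N.PathTo u → ℝ
  | _, input _ => 1
  | _, step (u := u) (v := v) p _ => p.weight w * w u v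

instance finite (v : N.Node) : Finite (N.PathTo v) := by
  suffices h : ∀ n : ℕ, ∀ v : N.Node, v.1.val < n → Finite (N.PathTo v) from
    h _ v (Nat.lt_succ_self _)
  intro n
  induction n with
  | zero => intro v hv; omega
  | succ n ih =>
    intro v hv
    have : ∀ u : {u : N.Node // N.edge u v}, Finite (N.PathTo u.1) := fun u =>
      ih u.1 (by have := N.edge_lt _ _ u.2; omega)
    let f : {i : Fin N.dx // N.inputNode i = v} ⊕ (Σ u : {u : N.Node // N.edge u v}, N.PathTo u.1) →
        N.PathTo v :=
      Sum.elim (fun i => i.2 ▸ PathTo.input i.1) (fun q => PathTo.step q.2 q.1.2)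
    apply Finite.of_surjective f
    intro p
    cases p with
    | input i => exact ⟨Sum.inl ⟨i, rfl⟩, rfl⟩
    | @step u _ q e => exact ⟨Sum.inr ⟨⟨u, e⟩, q⟩, rfl⟩

end PathTo

/-- The paths from the input to the output layer, without their final output unit: a path to a
unit that is joined to at least one output unit. This is the index set of the vectors
`x̄ ∘ σ̄` and `w̄_k`. -/
abbrev Path : Type := Σ u : {u : N.Node // ∃ k, N.edge u (N.outputNode k)}, N.PathTo u.1

instance : Fintype N.Path := Fintype.ofFinite _

instance : DecidableEq N.Path := Classical.decEq _

/-- The number of paths. -/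
def dz : ℕ := Fintype.card N.Path

/-- The vector `x̄ ∘ σ̄(x, w)` of deep-path features. -/
def feature (w : N.Weights) (x : Fin N.dx → ℝ) (p : N.Path) : ℝ :=
  p.2.inputValue x * p.2.activation w x

open Classical in
/-- The vectors `w̄_k` of path weights of the weights `w`: each entry is the product of the weights
along the path up to the `k`-th output unit (and `0` if the path does not lead there). -/
def pathWeight (w : N.Weights) (k : Fin N.dy) (p : N.Path) : ℝ :=
  if N.edge p.1.1 (N.outputNode k) then p.2.weight w * w p.1.1 (N.outputNode k) else 0

/-- The model `x ↦ ([x̄ ∘ σ̄(x, w_σ)]ᵀ w̄_k)_k` with frozen activation weights `wσ` and path-weight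
vectors `wbar`. -/
def model (wσ : N.Weights) (wbar : Fin N.dy → N.Path → ℝ) (x : Fin N.dx → ℝ) (k : Fin N.dy) : ℝ :=
  ∑ p, N.feature wσ x p * wbar k p

open Classical in
theorem preact_of_ne_zero (w : N.Weights) (x : Fin N.dx → ℝ) (v : N.Node) (hv : v.1 ≠ 0) :
    N.preact w x v.1 v.2 = ∑ u : {u : N.Node // N.edge u v},
      w u.1 v * (N.activation w x u.1 * N.preact w x u.1.1 u.1.2) := by
  obtain ⟨⟨l, hl⟩, j⟩ := v
  cases l with
  | zero => exact absurd rfl hv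
  | succ l => rw [preact]; rfl

open Classical in
/-- The output of a unit is the sum of the contributions of the paths to it. -/
theorem output_eq_sum (w : N.Weights) (x : Fin N.dx → ℝ) (v : N.Node)  :
    N.activation w x v * N.preact w x v.1 v.2 =
      ∑ᶠ p : N.PathTo v, p.inputValue x * p.activation w x * p.weight w := by
  suffices h : ∀ n : ℕ, ∀ v : N.Node, v.1.val < n → N.activation w x v * N.preact w x v.1 v.2 =
      ∑ᶠ p : N.PathTo v, p.inputValue x * p.activation w x * p.weight w from
    h _ v (Nat.lt_succ_self _)
  intro n
  induction n with
  | zero => intro v hv; omega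
  | succ n ih =>
    intro v hv
    by_cases h0 : v.1 = 0
    · obtain ⟨l, j⟩ := v
      obtain rfl : l = 0 := h0
      have hu : ∀ p : N.PathTo ⟨0, j⟩, p = PathTo.input j := by
        intro p
        cases p with
        | input i => rfl
        | @step u _ q e => exact absurd (N.edge_lt _ _ e) (by simp)
      have : Unique (N.PathTo ⟨0, j⟩) := ⟨⟨PathTo.input j⟩, hu⟩
      rw [finsum_unique, hu default]
      have : N.preact w x 0 j = x j := by
        rw [preact.eq_def]
        rfl
      simp [PathTo.inputValue, PathTo.activation, PathTo.weight, activation, gate, this]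
    · let e : (Σ u : {u : N.Node // N.edge u v}, N.PathTo u.1) ≃ N.PathTo v :=
        Equiv.ofBijective (fun q => PathTo.step q.2 q.1.2) (by
          constructor
          · rintro ⟨⟨u, e⟩, q⟩ ⟨⟨u', e'⟩, q'⟩ h
            simp only [PathTo.step.injEq] at h
            obtain ⟨rfl, h⟩ := h
            cases h
            rfl
          · intro p
            cases p with
            | input i => exact absurd rfl h0
            | @step u _ q e => exact ⟨⟨⟨u, e⟩, q⟩, rfl⟩)
      have := fun u : N.Node => Fintype.ofFinite (N.PathTo u)
      rw [← finsum_comp_equiv e, finsum_eq_sum_of_fintype, Fintype.sum_sigma,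
        N.preact_of_ne_zero w x v h0, Finset.mul_sum]
      refine Finset.sum_congr rfl fun u _ => ?_
      rw [ih u.1 (by have := N.edge_lt _ _ u.2; omega), finsum_eq_sum_of_fintype,
        Finset.mul_sum, Finset.mul_sum]
      refine Finset.sum_congr rfl fun p _ => ?_
      change _ = p.inputValue x * (p.activation w x * N.activation w x v) * (p.weight w * w u.1 v)
      ring

/-- The `k`-th output `z^{[L]}_k(x, w)` of the network is `[x̄ ∘ σ̄(x, w)]ᵀ w̄_k`. -/
theorem preact_output (w : N.Weights) (x : Fin N.dx → ℝ) (k : Fin N.dy) :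
    N.preact w x (Fin.last _) k = N.model w (N.pathWeight w) x k := by
  classical
  have := fun u : N.Node => Fintype.ofFinite (N.PathTo u)
  have h := N.preact_of_ne_zero w x (N.outputNode k) (by simp [Fin.ext_iff])
  refine h.trans ?_
  have e1 : N.model w (N.pathWeight w) x k =
      ∑ u : {u : N.Node // ∃ k, N.edge u (N.outputNode k)}, ∑ p : N.PathTo u.1,
        N.feature w x ⟨u, p⟩ * N.pathWeight w k ⟨u, p⟩ := by
    rw [model, ← Fintype.sum_sigma']
    refine Finset.sum_congr ?_ fun _ _ => rfl
    ext; simp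
  have e2 : ∀ u : {u : N.Node // ∃ k, N.edge u (N.outputNode k)}, (∑ p : N.PathTo u.1,
        N.feature w x ⟨u, p⟩ * N.pathWeight w k ⟨u, p⟩) =
      if N.edge u.1 (N.outputNode k) then
        w u.1 (N.outputNode k) * (N.activation w x u.1 * N.preact w x u.1.1 u.1.2) else 0 := by
    intro u
    split_ifs with hu
    · rw [output_eq_sum, finsum_eq_sum_of_fintype, Finset.mul_sum]
      refine Finset.sum_congr rfl fun p _ => ?_
      simp only [feature, pathWeight, hu, if_true]
      ring
    · simp [pathWeight, hu]
  rw [e1, Finset.sum_congr rfl fun u _ => e2 u, ← Finset.sum_filter]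
  refine Finset.sum_bij' (fun u _ => ⟨u.1, k, u.2⟩)
    (fun u hu => ⟨u.1, (Finset.mem_filter.1 hu).2⟩) ?_ ?_ ?_ ?_ ?_
  · intro u _; simpa using u.2
  all_goals simp

end Architecture

/-- Squared loss. -/
def sqLoss {d : ℕ} (a y : Fin d → ℝ) : ℝ := ∑ k, (a k - y k) ^ 2

/-- Expected risk for the squared loss. -/
def risk {d d' : ℕ} (P : Measure ((Fin d → ℝ) × (Fin d' → ℝ)))
    (f : (Fin d → ℝ) → Fin d' → ℝ) : ℝ :=
  ∫ s, sqLoss (f s.1) s.2 ∂P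

/-- Empirical risk for the squared loss on a finite family of examples. -/
def empRisk {d d' : ℕ} {ι : Type} [Fintype ι] (t : ι → (Fin d → ℝ) × (Fin d' → ℝ))
    (f : (Fin d → ℝ) → Fin d' → ℝ) : ℝ :=
  (∑ i, sqLoss (f (t i).1) (t i).2) / Fintype.card ι

/-- The largest eigenvalue of a real symmetric matrix. -/
def lambdaMax {ι : Type} [Fintype ι] [DecidableEq ι] (A : Matrix ι ι ℝ) : ℝ :=
  sSup (spectrum ℝ A)

/-- The spectral norm of a real matrix. -/
def spectralNorm₂ {ι : Type} [Fintype ι] [DecidableEq ι] (A : Matrix ι ι ℝ) : ℝ :=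
  ‖Matrix.toEuclideanCLM (n := ι) (𝕜 := ℝ) A‖

namespace Architecture

variable (N : Architecture)

/-- `G = 𝔼[z̃ z̃ᵀ] - z̃ z̃ᵀ` at an example, where `z̃ = x̄ ∘ σ̄(x, w_σ)`. -/
def devG (P : Measure N.Example) (wσ : N.Weights) (s : N.Example) : Matrix N.Path N.Path ℝ :=
  Matrix.of fun p q => (∫ r, N.feature wσ r.1 p * N.feature wσ r.1 q ∂P) -
    N.feature wσ s.1 p * N.feature wσ s.1 q

/-- `V_{k,p} = y_k z̃_p - 𝔼[y_k z̃_p]` at an example. -/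
def devV (P : Measure N.Example) (wσ : N.Weights) (s : N.Example) (k : Fin N.dy) (p : N.Path) : ℝ :=
  s.2 k * N.feature wσ s.1 p - ∫ r, r.2 k * N.feature wσ r.1 p ∂P

/-- `c_y = 𝔼‖y‖₂² - ‖y‖₂²` at an example. -/
def devY (P : Measure N.Example) (s : N.Example) : ℝ :=
  (∫ r, ∑ k, r.2 k ^ 2 ∂P) - ∑ k, s.2 k ^ 2

/-- The boundedness and variance conditions on one example drawn from `P`. The first field says
that the entries of `𝔼[z̃ z̃ᵀ]` and `𝔼[G²]` are finite; the other expectations are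
automatically finite by the almost sure bounds. -/
structure BoundedVariance (P : Measure N.Example) (wσ : N.Weights)
    (Czz γzz Cyz γyz Cy γy : ℝ) : Prop where
  moment : ∀ p, MemLp (fun s : N.Example => N.feature wσ s.1 p) 4 P
  bound_zz : ∀ᵐ s ∂P, lambdaMax (N.devG P wσ s) ≤ Czz
  var_zz : spectralNorm₂ (Matrix.of fun p q =>
    ∫ s, (N.devG P wσ s * N.devG P wσ s) p q ∂P) ≤ γzz ^ 2
  bound_yz : ∀ᵐ s ∂P, ∀ k p, |N.devV P wσ s k p| ≤ Cyz
  var_yz : ∀ k p, ∫ s, N.devV P wσ s k p ^ 2 ∂P ≤ γyz ^ 2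
  bound_y : ∀ᵐ s ∂P, |N.devY P s| ≤ Cy
  var_y : ∫ s, N.devY P s ^ 2 ∂P ≤ γy ^ 2

end Architecture

/-- The dataset of size `m` with first `n` examples `s` and remaining examples `t`. -/
def joinData {E : Type} {m n : ℕ} (s : {i : Fin m // i.val < n} → E)
    (t : {i : Fin m // n ≤ i.val} → E) (i : Fin m) : E :=
  if h : i.val < n then s ⟨i, h⟩ else t ⟨i, not_lt.mp h⟩

/-- The Bernstein-type quantity `2C/(3M) · ln(D/δ) + √(2γ²/M · ln(D/δ))`. -/
def bernsteinTerm (C γ M D δ : ℝ) : ℝ :=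
  2 * C / (3 * M) * Real.log (D / δ) + Real.sqrt (2 * γ ^ 2 / M * Real.log (D / δ))

end

/-! Once `w_σ` is frozen, the model is linear in the vectors `w̄_k`, so the gap between risk and
empirical risk is a quadratic polynomial in them. Its coefficients are the averages of `G`, `V` and
`c_y` over the second part of the data (`risk_sub_sqLoss`). The gap is therefore at most `λ_max` of
the averaged `G` times `∑ ‖w̄_k‖₂²`, plus twice the largest averaged `|V_{kp}|` times `∑ ‖w̄_k‖₁`,
plus the averaged `c_y` (`risk_sub_empRisk_le`). None of the three random quantities involves `w̄`,
so `w̄` may depend on the whole sample in any way and no uniform convergence argument is needed.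

Given `S_{αm}`, independence makes the remaining examples an i.i.d. sample from `P` while `w_σ` is
constant (`condDistrib_ae_eq`). Each of the three quantities is then an average of centred
independent terms and gets failure probability `δ/3`: matrix Bernstein for `G`, scalar Bernstein
with a union bound over entries and signs for `V`, scalar Bernstein for `c_y`.

Matrix Bernstein is proved by the Laplace transform. Markov's inequality is applied to the trace of
the exponential of the sum, and Golden–Thompson peels off one summand at a time
(`integral_trace_exp_sum_le`). Since all summands share one variance bound, this peeling gives the
required constants. Golden–Thompson follows from the Lie product formula and a trace inequality for
powers `2 ^ k`, itself an iterated Cauchy–Schwarz inequality. -/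

/-! ### Exponentials in a Banach algebra and the Lie product formula. -/

theorem NormedSpace.norm_exp_le_exp_norm {𝔸 : Type*} [NormedRing 𝔸] [NormedAlgebra ℝ 𝔸]
    [NormOneClass 𝔸] [CompleteSpace 𝔸] (x : 𝔸) : ‖NormedSpace.exp x‖ ≤ Real.exp ‖x‖ := by
  rw [NormedSpace.exp_eq_tsum ℝ, Real.exp_eq_exp_ℝ, NormedSpace.exp_eq_tsum ℝ]
  refine (norm_tsum_le_tsum_norm (NormedSpace.norm_expSeries_summable' x)).trans ?_
  refine (NormedSpace.norm_expSeries_summable' x).tsum_le_tsum (fun n => ?_)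
    (NormedSpace.expSeries_summable' ‖x‖)
  rw [norm_smul, smul_eq_mul, Real.norm_of_nonneg (by positivity)]
  gcongr
  exact norm_pow_le x n

/-- Telescoping gives `n` terms, each with one factor `x - y`. The exponent `n` in place of `n - 1`
is a harmless loss, paid for by `1 ≤ r`. -/
theorem norm_pow_sub_pow_le_of_norm_le {𝔸 : Type*} [NormedRing 𝔸] [NormOneClass 𝔸] {x y : 𝔸} {r : ℝ}
    (hx : ‖x‖ ≤ r) (hy : ‖y‖ ≤ r) (hr : 1 ≤ r) (n : ℕ) :
    ‖x ^ n - y ^ n‖ ≤ n * r ^ n * ‖x - y‖ := by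
  induction n with
  | zero => simp
  | succ n ih =>
    have h : x ^ (n + 1) - y ^ (n + 1) = x ^ n * (x - y) + (x ^ n - y ^ n) * y := by
      rw [pow_succ, pow_succ]; noncomm_ring
    have hr0 : 0 ≤ r := by linarith
    calc ‖x ^ (n + 1) - y ^ (n + 1)‖ ≤ r ^ n * ‖x - y‖ + (n * r ^ n * ‖x - y‖) * r := by
          rw [h]
          refine (norm_add_le _ _).trans (add_le_add ?_ ?_)
          · refine (norm_mul_le _ _).trans ?_
            gcongr
            exact (norm_pow_le x n).trans (by gcongr)
          · refine (norm_mul_le _ _).trans ?_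
            gcongr
      _ ≤ r ^ (n + 1) * ‖x - y‖ + (n * r ^ n * ‖x - y‖) * r := by
          have := pow_le_pow_right₀ hr n.le_succ
          gcongr
      _ = _ := by push_cast; ring

/-- The **Lie product formula**. -/
theorem NormedSpace.tendsto_exp_mul_exp_pow {𝔸 : Type*} [NormedRing 𝔸] [NormedAlgebra ℝ 𝔸]
    [NormOneClass 𝔸] [CompleteSpace 𝔸] (a b : 𝔸) :
    Filter.Tendsto (fun n : ℕ => (NormedSpace.exp ((n : ℝ)⁻¹ • a) *
      NormedSpace.exp ((n : ℝ)⁻¹ • b)) ^ n) Filter.atTop (nhds (NormedSpace.exp (a + b))) := by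
  -- Both curves have value `1` and derivative `a + b` at `t = 0`, so they differ by `o(t)`. Raising
  -- to the power `n` at `t = 1/n` multiplies this error by about `n`, which still tends to `0`.
  have hlit : (fun t : ℝ => NormedSpace.exp (t • a) * NormedSpace.exp (t • b) -
      NormedSpace.exp (t • (a + b))) =o[nhds 0] fun t => t := by
    have hd := (((hasDerivAt_exp_smul_const (𝕂 := ℝ) a 0).mul
      (hasDerivAt_exp_smul_const (𝕂 := ℝ) b 0)).sub
        (hasDerivAt_exp_smul_const (𝕂 := ℝ) (a + b) 0))
    have := hd.isLittleO
    simpa using this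
  have hinv : Filter.Tendsto (fun n : ℕ => (n : ℝ)⁻¹) Filter.atTop (nhds 0) :=
    tendsto_inv_atTop_zero.comp tendsto_natCast_atTop_atTop
  have h1 := (hlit.comp_tendsto hinv)
  have h2 : Filter.Tendsto (fun n : ℕ => (n : ℝ) * ‖NormedSpace.exp ((n : ℝ)⁻¹ • a) *
      NormedSpace.exp ((n : ℝ)⁻¹ • b) - NormedSpace.exp ((n : ℝ)⁻¹ • (a + b))‖) Filter.atTop
      (nhds 0) := by
    have := h1.norm_left.tendsto_div_nhds_zero
    refine this.congr fun n => ?_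
    simp [div_inv_eq_mul, mul_comm]
  have h3 := h2.const_mul (Real.exp (‖a‖ + ‖b‖))
  rw [mul_zero] at h3
  rw [tendsto_iff_norm_sub_tendsto_zero]
  refine squeeze_zero' (Filter.Eventually.of_forall fun _ => norm_nonneg _) ?_ h3
  filter_upwards [Filter.eventually_gt_atTop 0] with n hn
  have hn' : (n : ℝ) ≠ 0 := by positivity
  let _ : NormedAlgebra ℚ 𝔸 := NormedAlgebra.restrictScalars ℚ ℝ 𝔸
  have e1 : NormedSpace.exp (a + b) = NormedSpace.exp ((n : ℝ)⁻¹ • (a + b)) ^ n := by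
    rw [← NormedSpace.exp_nsmul, ← Nat.cast_smul_eq_nsmul ℝ, smul_smul, mul_inv_cancel₀ hn',
      one_smul]
  -- The common norm bound `r` of both bases is chosen so that `r ^ n` does not depend on `n`.
  have e2 : Real.exp (‖a‖ + ‖b‖) = Real.exp ((n : ℝ)⁻¹ * (‖a‖ + ‖b‖)) ^ n := by
    rw [← Real.exp_nat_mul, mul_inv_cancel_left₀ hn']
  have hs : ∀ c : 𝔸, ‖(n : ℝ)⁻¹ • c‖ = (n : ℝ)⁻¹ * ‖c‖ := fun c => by
    rw [norm_smul, Real.norm_of_nonneg (by positivity)]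
  rw [e1, e2]
  refine (norm_pow_sub_pow_le_of_norm_le (r := Real.exp ((n : ℝ)⁻¹ * (‖a‖ + ‖b‖))) ?_ ?_ (Real.one_le_exp (by positivity)) n).trans_eq
    (by ring)
  · refine (norm_mul_le _ _).trans ?_
    rw [mul_add, Real.exp_add, ← hs, ← hs]
    exact mul_le_mul (norm_exp_le_exp_norm _) (norm_exp_le_exp_norm _) (norm_nonneg _)
      (Real.exp_pos _).le
  · refine (norm_exp_le_exp_norm _).trans (Real.exp_le_exp.2 ?_)
    rw [hs]
    gcongr
    exact norm_add_le _ _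

/-! ### The Golden–Thompson inequality. -/

namespace Matrix

/-- Cauchy–Schwarz for the Frobenius inner product of `A` and `Bᵀ`. -/
theorem trace_mul_sq_le {ι : Type*} [Fintype ι] (A B : Matrix ι ι ℝ) :
    (A * B).trace ^ 2 ≤ (A * Aᵀ).trace * (B * Bᵀ).trace := by
  have h := Finset.sum_mul_sq_le_sq_mul_sq (Finset.univ : Finset (ι × ι))
    (fun p => A p.1 p.2) (fun p => B p.2 p.1)
  simp only [Fintype.sum_prod_type] at h
  rw [Finset.sum_comm (f := fun i j => B j i ^ 2)] at h
  simpa [trace, mul_apply, sq] using h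

variable {ι : Type*} [Fintype ι] [DecidableEq ι]

theorem trace_mul_pow_comm (A B : Matrix ι ι ℝ) (n : ℕ) :
    ((A * B) ^ n).trace = ((B * A) ^ n).trace := by
  cases n with
  | zero => simp
  | succ n =>
    have h : (A * B) ^ n * A = A * (B * A) ^ n := by
      induction n with
      | zero => simp
      | succ n ih => rw [pow_succ', mul_assoc, ih, pow_succ']; simp only [mul_assoc]
    rw [pow_succ, ← mul_assoc, h, mul_assoc, trace_mul_comm, mul_assoc, pow_succ]

/-- Doubling the exponent replaces the pair by `(AB, AB)`. Cyclicity of the trace turns the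
resulting `AB(AB)ᵀ` into `(AᵀA)(BBᵀ)`, to which the induction hypothesis applies again. -/
theorem trace_mul_pow_two_pow_sq_le (k : ℕ) (A B : Matrix ι ι ℝ) :
    ((A * B) ^ 2 ^ k).trace ^ 2 ≤
      ((A * Aᵀ) ^ 2 ^ k).trace * ((B * Bᵀ) ^ 2 ^ k).trace := by
  induction k generalizing A B with
  | zero => simpa using trace_mul_sq_le A B
  | succ k ih =>
    have h1 := ih (A * B) (A * B)
    have h2 := ih (Aᵀ * A) (B * Bᵀ)
    have e : ((A * B * (A * B)ᵀ) ^ 2 ^ k).trace = ((Aᵀ * A * (B * Bᵀ)) ^ 2 ^ k).trace := by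
      rw [transpose_mul, ← mul_assoc, trace_mul_pow_comm]
      simp only [mul_assoc]
    simp only [transpose_mul, transpose_transpose, ← sq, ← pow_mul, ← pow_succ'] at h1 h2 e
    rw [e] at h1
    rw [trace_mul_pow_comm Aᵀ A] at h2
    exact h1.trans h2

theorem IsSymm.trace_mul_pow_two_pow_le {A B : Matrix ι ι ℝ} (hA : A.IsSymm) (hB : B.IsSymm)
    (k : ℕ) : ((A * B) ^ 2 ^ k).trace ≤ (A ^ 2 ^ k * B ^ 2 ^ k).trace := by
  induction k generalizing A B with
  | zero => simp
  | succ k ih =>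
    -- Both factors on the right coincide, so this compares squares. By cyclicity `AB(AB)ᵀ = AB²A`
    -- can be traded for `A²B²`, and the induction continues with `A²` and `B²`.
    have h1 := trace_mul_pow_two_pow_sq_le k (A * B) (A * B)
    have e : ((A * B * (A * B)ᵀ) ^ 2 ^ k).trace = ((A ^ 2 * B ^ 2) ^ 2 ^ k).trace := by
      rw [transpose_mul, hA.eq, hB.eq, ← mul_assoc, trace_mul_pow_comm, sq, sq]
      simp only [mul_assoc]
    have h0 : 0 ≤ ((A * B * (A * B)ᵀ) ^ 2 ^ k).trace := by
      have : (A * B * (A * B)ᵀ).PosSemidef := by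
        simpa using posSemidef_self_mul_conjTranspose (A * B)
      exact (this.pow _).trace_nonneg
    rw [← sq, ← sq, ← pow_mul, ← pow_succ'] at h1
    refine ((abs_le_of_sq_le_sq' h1 h0).2.trans_eq e).trans ((ih (hA.pow 2) (hB.pow 2)).trans_eq ?_)
    rw [← pow_mul, ← pow_mul, ← pow_succ']

open scoped Matrix.Norms.Operator in
/-- The **Golden–Thompson inequality** for real symmetric matrices. -/
theorem IsSymm.trace_exp_add_le {A B : Matrix ι ι ℝ} (hA : A.IsSymm) (hB : B.IsSymm) :
    (NormedSpace.exp (A + B)).trace ≤ (NormedSpace.exp A * NormedSpace.exp B).trace := by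
  -- `‖1‖ = 1` needs a nonempty index type.
  cases isEmpty_or_nonempty ι
  · simp [trace]
  -- The Lie formula is used only along `n = 2 ^ k`, where the trace inequality is available.
  -- Applied to the exponentials of `A / 2 ^ k` and `B / 2 ^ k`, its right side is independent of
  -- `k`.
  have h := (NormedSpace.tendsto_exp_mul_exp_pow A B).comp
    (tendsto_pow_atTop_atTop_of_one_lt (one_lt_two (α := ℕ)))
  have hc : Continuous (trace : Matrix ι ι ℝ → ℝ) := continuous_id.matrix_trace
  refine le_of_tendsto ((hc.tendsto _).comp h) (Filter.Eventually.of_forall fun k => ?_)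
  have e : ∀ C : Matrix ι ι ℝ,
      NormedSpace.exp (((2 ^ k : ℕ) : ℝ)⁻¹ • C) ^ 2 ^ k = NormedSpace.exp C := fun C => by
    rw [← Matrix.exp_nsmul, ← Nat.cast_smul_eq_nsmul ℝ, smul_smul,
      mul_inv_cancel₀ (by positivity), one_smul]
  have := IsSymm.trace_mul_pow_two_pow_le (hA.smul ((2 ^ k : ℕ) : ℝ)⁻¹).exp
    (hB.smul ((2 ^ k : ℕ) : ℝ)⁻¹).exp k
  rwa [e, e] at this

end Matrix

/-! ### Spectral calculus for real symmetric matrices through quadratic forms. -/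

namespace Matrix

variable {ι : Type*} [Fintype ι] [DecidableEq ι]

theorem IsSymm.exists_eq_mul_diagonal_mul_transpose {A : Matrix ι ι ℝ} (hA : A.IsSymm) :
    ∃ (U : Matrix ι ι ℝ) (d : ι → ℝ), U * Uᵀ = 1 ∧ Uᵀ * U = 1 ∧ A = U * diagonal d * Uᵀ ∧
      ∀ i, d i ∈ spectrum ℝ A := by
  have hA' : A.IsHermitian := by simpa [IsHermitian, IsSymm] using hA
  refine ⟨hA'.eigenvectorUnitary, hA'.eigenvalues, ?_, ?_, ?_, hA'.eigenvalues_mem_spectrum_real⟩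
  · simpa [star_eq_conjTranspose] using Unitary.coe_mul_star_self hA'.eigenvectorUnitary
  · simpa [star_eq_conjTranspose] using Unitary.coe_star_mul_self hA'.eigenvectorUnitary
  · have := hA'.spectral_theorem
    rw [Unitary.conjStarAlgAut_apply] at this
    simpa [star_eq_conjTranspose, Function.comp_def] using this

theorem dotProduct_mul_diagonal_mul_transpose_mulVec (U : Matrix ι ι ℝ) (d v : ι → ℝ) :
    v ⬝ᵥ (U * diagonal d * Uᵀ) *ᵥ v = ∑ i, d i * (Uᵀ *ᵥ v) i ^ 2 := by
  rw [← mulVec_mulVec, ← mulVec_mulVec, dotProduct_mulVec, ← mulVec_transpose, dotProduct]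
  refine Finset.sum_congr rfl fun i _ => ?_
  rw [mulVec_diagonal]
  ring

theorem sum_transpose_mulVec_sq {U : Matrix ι ι ℝ} (hU : U * Uᵀ = 1) (v : ι → ℝ) :
    ∑ i, (Uᵀ *ᵥ v) i ^ 2 = v ⬝ᵥ v := by
  have := dotProduct_mul_diagonal_mul_transpose_mulVec U 1 v
  simp only [Pi.one_apply, one_mul] at this
  rw [← this]
  simp [hU]

theorem mul_diagonal_mul_transpose_mul_self {U : Matrix ι ι ℝ} (hU : Uᵀ * U = 1) (d : ι → ℝ) :
    U * diagonal d * Uᵀ * (U * diagonal d * Uᵀ) = U * diagonal (fun i => d i ^ 2) * Uᵀ := by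
  have : U * diagonal d * Uᵀ * (U * diagonal d * Uᵀ) =
      U * (diagonal d * (Uᵀ * U) * diagonal d) * Uᵀ := by simp only [mul_assoc]
  rw [this, hU, mul_one, diagonal_mul_diagonal]
  simp only [sq]

theorem exp_mul_diagonal_mul_transpose {U : Matrix ι ι ℝ} (hU : U * Uᵀ = 1) (d : ι → ℝ) :
    NormedSpace.exp (U * diagonal d * Uᵀ) = U * diagonal (fun i => Real.exp (d i)) * Uᵀ := by
  have h := exp_conj U (diagonal d) (IsUnit.of_mul_eq_one _ hU)
  rw [inv_eq_right_inv hU, exp_diagonal] at h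
  rw [h]
  congr 3
  ext i
  rw [Pi.coe_exp, Real.exp_eq_exp_ℝ]

/-- Test the form on the `i`-th column of `U`, a unit eigenvector. -/
theorem diagonal_le_of_forall_dotProduct_mulVec_le {U : Matrix ι ι ℝ} (hU : Uᵀ * U = 1)
    {d : ι → ℝ} {c : ℝ} (h : ∀ v, v ⬝ᵥ (U * diagonal d * Uᵀ) *ᵥ v ≤ c * (v ⬝ᵥ v)) (i : ι) :
    d i ≤ c := by
  have e : Uᵀ *ᵥ (U *ᵥ Pi.single i 1) = Pi.single i 1 := by
    rw [mulVec_mulVec, hU, one_mulVec]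
  have h1 := h (U *ᵥ Pi.single i 1)
  rw [dotProduct_mul_diagonal_mul_transpose_mulVec,
    ← sum_transpose_mulVec_sq (mul_eq_one_comm.1 hU), e] at h1
  simpa [Pi.single_apply] using h1

/-- A quadratic upper bound on the exponential carries over from reals to symmetric matrices. -/
theorem IsSymm.dotProduct_exp_mulVec_le {A : Matrix ι ι ℝ} (hA : A.IsSymm) {c g : ℝ}
    (hc : ∀ v, v ⬝ᵥ A *ᵥ v ≤ c * (v ⬝ᵥ v)) (hg : ∀ x ≤ c, Real.exp x ≤ 1 + x + g * x ^ 2)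
    (v : ι → ℝ) : v ⬝ᵥ NormedSpace.exp A *ᵥ v ≤
      v ⬝ᵥ v + v ⬝ᵥ A *ᵥ v + g * (v ⬝ᵥ (A * A) *ᵥ v) := by
  obtain ⟨U, d, h1, h2, rfl, -⟩ := hA.exists_eq_mul_diagonal_mul_transpose
  rw [exp_mul_diagonal_mul_transpose h1, mul_diagonal_mul_transpose_mul_self h2]
  simp only [dotProduct_mul_diagonal_mul_transpose_mulVec]
  rw [← sum_transpose_mulVec_sq h1 v, Finset.mul_sum, ← Finset.sum_add_distrib,
    ← Finset.sum_add_distrib]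
  refine Finset.sum_le_sum fun i _ => ?_
  have := mul_le_mul_of_nonneg_right
    (hg _ (diagonal_le_of_forall_dotProduct_mulVec_le h2 hc i)) (sq_nonneg ((Uᵀ *ᵥ v) i))
  linarith

theorem IsSymm.dotProduct_exp_mulVec_nonneg {A : Matrix ι ι ℝ} (hA : A.IsSymm) (v : ι → ℝ) :
    0 ≤ v ⬝ᵥ NormedSpace.exp A *ᵥ v := by
  obtain ⟨U, d, h1, h2, rfl, -⟩ := hA.exists_eq_mul_diagonal_mul_transpose
  rw [exp_mul_diagonal_mul_transpose h1, dotProduct_mul_diagonal_mul_transpose_mulVec]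
  positivity

/-- Serves integrability: a one-sided bound on the form already bounds every entry of the
exponential, because the rows of `U` are unit vectors. -/
theorem IsSymm.abs_exp_apply_le {A : Matrix ι ι ℝ} (hA : A.IsSymm) {c : ℝ}
    (hc : ∀ v, v ⬝ᵥ A *ᵥ v ≤ c * (v ⬝ᵥ v)) (p q : ι) :
    |NormedSpace.exp A p q| ≤ Real.exp c := by
  obtain ⟨U, d, h1, h2, rfl, -⟩ := hA.exists_eq_mul_diagonal_mul_transpose
  have hrow : ∀ p, ∑ i, U p i ^ 2 = 1 := fun p => by
    have := congrFun (congrFun h1 p) p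
    simpa [mul_apply, sq] using this
  rw [exp_mul_diagonal_mul_transpose h1, mul_apply]
  simp only [mul_diagonal, transpose_apply]
  calc |∑ i, U p i * Real.exp (d i) * U q i| ≤ ∑ i, |U p i * Real.exp (d i) * U q i| :=
        Finset.abs_sum_le_sum_abs _ _
    _ ≤ ∑ i, Real.exp c * ((U p i ^ 2 + U q i ^ 2) / 2) := by
        refine Finset.sum_le_sum fun i _ => ?_
        have h3 := diagonal_le_of_forall_dotProduct_mulVec_le h2 hc i
        have h4 : |U p i| * |U q i| ≤ (U p i ^ 2 + U q i ^ 2) / 2 := by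
          have := two_mul_le_add_sq |U p i| |U q i|
          simp only [sq_abs] at this
          linarith
        rw [abs_mul, abs_mul, Real.abs_exp, mul_right_comm, mul_comm]
        gcongr
    _ = Real.exp c := by
        rw [← Finset.mul_sum, ← Finset.sum_div, Finset.sum_add_distrib, hrow, hrow]
        norm_num

/-- Some eigenvalue is at least `t`, and the trace of the exponential is a sum of positive terms
containing its exponential. This reduces a tail event for the top eigenvalue to one for a scalar. -/
theorem IsSymm.exp_le_trace_exp {A : Matrix ι ι ℝ} (hA : A.IsSymm) {t : ℝ} {v : ι → ℝ}
    (hv : t * (v ⬝ᵥ v) < v ⬝ᵥ A *ᵥ v) : Real.exp t ≤ (NormedSpace.exp A).trace := by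
  obtain ⟨U, d, h1, h2, rfl, -⟩ := hA.exists_eq_mul_diagonal_mul_transpose
  obtain ⟨i, hi⟩ : ∃ i, t ≤ d i := by
    by_contra! h
    refine hv.not_ge ?_
    rw [dotProduct_mul_diagonal_mul_transpose_mulVec, ← sum_transpose_mulVec_sq h1,
      Finset.mul_sum]
    exact Finset.sum_le_sum fun i _ => mul_le_mul_of_nonneg_right (h i).le (sq_nonneg _)
  rw [exp_mul_diagonal_mul_transpose h1, trace_mul_comm, ← mul_assoc, h2, one_mul, trace_diagonal]
  exact (Real.exp_le_exp.2 hi).trans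
    (Finset.single_le_sum (f := fun i => Real.exp (d i)) (fun i _ => (Real.exp_pos _).le)
      (Finset.mem_univ i))

theorem IsSymm.trace_exp_nonneg {A : Matrix ι ι ℝ} (hA : A.IsSymm) :
    0 ≤ (NormedSpace.exp A).trace := by
  obtain ⟨U, d, h1, h2, rfl, -⟩ := hA.exists_eq_mul_diagonal_mul_transpose
  rw [exp_mul_diagonal_mul_transpose h1, trace_mul_comm, ← mul_assoc, h2, one_mul, trace_diagonal]
  positivity

/-- In an eigenbasis of `A` the trace is a sum of nonnegative eigenvalues times values of the form
of `B` at unit vectors; `B` need not be symmetric. -/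
theorem IsSymm.trace_mul_le {A B : Matrix ι ι ℝ} (hA : A.IsSymm) (hA0 : ∀ v, 0 ≤ v ⬝ᵥ A *ᵥ v)
    {c : ℝ} (hB : ∀ v, v ⬝ᵥ B *ᵥ v ≤ c * (v ⬝ᵥ v)) : (A * B).trace ≤ A.trace * c := by
  obtain ⟨U, d, h1, h2, rfl, -⟩ := hA.exists_eq_mul_diagonal_mul_transpose
  have hd : ∀ i, 0 ≤ d i := fun i => by
    have e : Uᵀ *ᵥ (U *ᵥ Pi.single i 1) = Pi.single i 1 := by
      rw [mulVec_mulVec, h2, one_mulVec]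
    have := hA0 (U *ᵥ Pi.single i 1)
    rw [dotProduct_mul_diagonal_mul_transpose_mulVec, e] at this
    simpa [Pi.single_apply] using this
  have e1 : (U * diagonal d * Uᵀ).trace = ∑ i, d i := by
    rw [trace_mul_comm, ← mul_assoc, h2, one_mul, trace_diagonal]
  have e2 : (U * diagonal d * Uᵀ * B).trace = ∑ i, d i * (Uᵀ * B * U) i i := by
    rw [mul_assoc, mul_assoc, trace_mul_comm, mul_assoc, trace]
    simp [diagonal_mul]
  rw [e1, e2, Finset.sum_mul]
  refine Finset.sum_le_sum fun i _ => mul_le_mul_of_nonneg_left ?_ (hd i)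
  have h3 := hB (U *ᵥ Pi.single i 1)
  have e3 : (U *ᵥ Pi.single i 1) ⬝ᵥ (U *ᵥ Pi.single i 1) = 1 := by
    rw [dotProduct_mulVec, vecMul_mulVec, h2]
    simp
  have e4 : (U *ᵥ Pi.single i 1) ⬝ᵥ B *ᵥ (U *ᵥ Pi.single i 1) = (Uᵀ * B * U) i i := by
    rw [mulVec_mulVec, dotProduct_mulVec, vecMul_mulVec, ← mul_assoc]
    simp
  rw [e3, e4, mul_one] at h3
  exact h3

theorem dotProduct_mulVec_eq_sum {ι : Type*} [Fintype ι] (A : Matrix ι ι ℝ) (v : ι → ℝ) :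
    v ⬝ᵥ A *ᵥ v = ∑ p, ∑ q, v p * v q * A p q := by
  simp only [dotProduct, mulVec, Finset.mul_sum]
  refine Finset.sum_congr rfl fun p _ => Finset.sum_congr rfl fun q _ => ?_
  ring

theorem integral_dotProduct_mulVec {ι Ω : Type*} [Fintype ι] [MeasurableSpace Ω] {μ : Measure Ω}
    {A : Ω → Matrix ι ι ℝ} (hA : ∀ p q, Integrable (fun ω => A ω p q) μ) (v : ι → ℝ) :
    ∫ ω, v ⬝ᵥ A ω *ᵥ v ∂μ = v ⬝ᵥ (of fun p q => ∫ ω, A ω p q ∂μ) *ᵥ v := by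
  simp only [dotProduct_mulVec_eq_sum]
  rw [integral_finsetSum _ fun p _ => integrable_finsetSum _ fun q _ => (hA p q).const_mul _]
  refine Finset.sum_congr rfl fun p _ => ?_
  rw [integral_finsetSum _ fun q _ => (hA p q).const_mul _]
  simp only [integral_const_mul, of_apply]

theorem integrable_dotProduct_mulVec {ι Ω : Type*} [Fintype ι] [MeasurableSpace Ω] {μ : Measure Ω}
    {A : Ω → Matrix ι ι ℝ} (hA : ∀ p q, Integrable (fun ω => A ω p q) μ) (v : ι → ℝ) :
    Integrable (fun ω => v ⬝ᵥ A ω *ᵥ v) μ := by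
  simp only [dotProduct_mulVec_eq_sum]
  exact integrable_finsetSum _ fun p _ => integrable_finsetSum _ fun q _ => (hA p q).const_mul _

end Matrix

/-! ### Trace exponential moments of sums of independent matrices. -/

namespace Matrix

variable {ι : Type*} [Fintype ι] [DecidableEq ι] {Ω : Type*} [MeasurableSpace Ω] {μ : Measure Ω}

open scoped Matrix.Norms.Operator in
theorem continuous_exp_of_apply (p q : ι) :
    Continuous fun A : ι → ι → ℝ => NormedSpace.exp (of A) p q := by
  have h1 : Continuous fun A : ι → ι → ℝ => (of A : Matrix ι ι ℝ) := continuous_id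
  exact (NormedSpace.exp_continuous.comp h1).matrix_elem p q

variable {κ : Type*} {X : κ → Ω → ι → ι → ℝ}

theorem isSymm_sum {ι Ω κ : Type*} {X : κ → Ω → ι → ι → ℝ} (hsymm : ∀ i ω, (of (X i ω)).IsSymm) (s : Finset κ) (ω : Ω) :
    (of ((∑ i ∈ s, X i) ω)).IsSymm := by
  ext p q
  simp only [transpose_apply, of_apply, Finset.sum_apply]
  exact Finset.sum_congr rfl fun i _ => (hsymm i ω).apply _ _

theorem dotProduct_sum_mulVec {ι Ω κ : Type*} [Fintype ι] {X : κ → Ω → ι → ι → ℝ} {s : Finset κ} {ω : Ω} (v : ι → ℝ) :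
    v ⬝ᵥ of ((∑ i ∈ s, X i) ω) *ᵥ v = ∑ i ∈ s, v ⬝ᵥ of (X i ω) *ᵥ v := by
  have : of ((∑ i ∈ s, X i) ω) = ∑ i ∈ s, (of (X i ω) : Matrix ι ι ℝ) := by
    ext p q
    simp [Matrix.sum_apply]
  rw [this, Matrix.sum_mulVec, dotProduct_sum]

theorem integrable_exp_of_apply [IsFiniteMeasure μ] {Y : Ω → ι → ι → ℝ} (hY : AEMeasurable Y μ)
    (hsymm : ∀ ω, (of (Y ω)).IsSymm) {c : ℝ}
    (hc : ∀ᵐ ω ∂μ, ∀ v, v ⬝ᵥ of (Y ω) *ᵥ v ≤ c * (v ⬝ᵥ v)) (p q : ι) :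
    Integrable (fun ω => NormedSpace.exp (of (Y ω)) p q) μ := by
  refine Integrable.of_bound
    ((continuous_exp_of_apply p q).measurable.comp_aemeasurable hY).aestronglyMeasurable
    (Real.exp c) ?_
  filter_upwards [hc] with ω hω
  exact (hsymm ω).abs_exp_apply_le hω p q

theorem integrable_exp_of_sum_apply [IsFiniteMeasure μ] (hX : ∀ i, AEMeasurable (X i) μ)
    (hsymm : ∀ i ω, (of (X i ω)).IsSymm) {c : ℝ}
    (hc : ∀ i, ∀ᵐ ω ∂μ, ∀ v, v ⬝ᵥ of (X i ω) *ᵥ v ≤ c * (v ⬝ᵥ v)) (s : Finset κ) :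
    ∀ p q, Integrable (fun ω => NormedSpace.exp (of ((∑ i ∈ s, X i) ω)) p q) μ := by
  refine integrable_exp_of_apply (c := s.card * c) (Finset.aemeasurable_sum s fun i _ => hX i)
    (isSymm_sum hsymm s) ?_
  have h := (Filter.eventually_all_finset s).2 fun i _ => hc i
  filter_upwards [h] with ω hω v
  rw [dotProduct_sum_mulVec, mul_assoc, ← nsmul_eq_mul]
  exact Finset.sum_le_card_nsmul _ _ _ fun i hi => hω i hi v

/-- The trace exponential moment of a sum of independent symmetric matrices. -/
theorem integral_trace_exp_sum_le [IsProbabilityMeasure μ] (hX : ∀ i, AEMeasurable (X i) μ)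
    (hind : iIndepFun X μ) (hsymm : ∀ i ω, (of (X i ω)).IsSymm) {c K : ℝ} (hK : 0 ≤ K)
    (hc : ∀ i, ∀ᵐ ω ∂μ, ∀ v, v ⬝ᵥ of (X i ω) *ᵥ v ≤ c * (v ⬝ᵥ v))
    (hexp : ∀ i v, ∫ ω, v ⬝ᵥ NormedSpace.exp (of (X i ω)) *ᵥ v ∂μ ≤ K * (v ⬝ᵥ v))
    (s : Finset κ) :
    ∫ ω, (NormedSpace.exp (of ((∑ i ∈ s, X i) ω))).trace ∂μ ≤ Fintype.card ι * K ^ s.card := by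
  classical
  have hint := integrable_exp_of_sum_apply hX hsymm hc
  have hinti : ∀ i p q, Integrable (fun ω => NormedSpace.exp (of (X i ω)) p q) μ := fun i =>
    integrable_exp_of_apply (hX i) (hsymm i) (hc i)
  induction s using Finset.induction_on with
  | empty =>
    have : ∀ ω, of ((∑ i ∈ (∅ : Finset κ), X i) ω) = (0 : Matrix ι ι ℝ) := fun ω => by
      simp
    simp
  | insert i s hi ih =>
    set Y := ∑ j ∈ s, X j with hY
    have hYX : IndepFun Y (X i) μ := hind.indepFun_finsetSum_of_notMem₀ hX hi
    set EY : Matrix ι ι ℝ := of fun p q => ∫ ω, NormedSpace.exp (of (Y ω)) p q ∂μ with hEY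
    set EX : Matrix ι ι ℝ := of fun p q => ∫ ω, NormedSpace.exp (of (X i ω)) p q ∂μ with hEX
    have hpq : ∀ p q, IndepFun (fun ω => NormedSpace.exp (of (Y ω)) p q)
        (fun ω => NormedSpace.exp (of (X i ω)) q p) μ := fun p q =>
      hYX.comp (continuous_exp_of_apply p q).measurable (continuous_exp_of_apply q p).measurable
    have hprod : ∀ p q, Integrable (fun ω => NormedSpace.exp (of (Y ω)) p q *
        NormedSpace.exp (of (X i ω)) q p) μ := fun p q =>
      (hpq p q).integrable_mul (hint s p q) (hinti i q p)
    have etr : ∀ ω, (NormedSpace.exp (of (Y ω)) * NormedSpace.exp (of (X i ω))).trace =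
        ∑ p, ∑ q, NormedSpace.exp (of (Y ω)) p q * NormedSpace.exp (of (X i ω)) q p := fun ω => by
      simp [trace, mul_apply]
    have htr : ∀ s : Finset κ,
        Integrable (fun ω => (NormedSpace.exp (of ((∑ i ∈ s, X i) ω))).trace) μ := fun s =>
      integrable_finsetSum _ fun p _ => hint s p p
    have eEY : ∫ ω, (NormedSpace.exp (of (Y ω))).trace ∂μ = EY.trace :=
      integral_finsetSum _ fun p _ => hint s p p
    -- Golden–Thompson splits off the summand `i`, independence factors the expectation entrywise,
    -- and the nonnegative form of `EY` allows `EX` to be replaced by the scalar `K`.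
    calc ∫ ω, (NormedSpace.exp (of ((∑ i ∈ insert i s, X i) ω))).trace ∂μ
        ≤ ∫ ω, (NormedSpace.exp (of (Y ω)) * NormedSpace.exp (of (X i ω))).trace ∂μ := by
          refine integral_mono (htr _) ?_ fun ω => ?_
          · simp only [etr]
            exact integrable_finsetSum _ fun p _ => integrable_finsetSum _ fun q _ => hprod p q
          · have : of ((∑ j ∈ insert i s, X j) ω) = (of (Y ω) + of (X i ω) : Matrix ι ι ℝ) := by
              rw [Finset.sum_insert hi, add_comm]
              rfl
            simp only [this]
            exact IsSymm.trace_exp_add_le (isSymm_sum hsymm s ω) (hsymm i ω)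
      _ = (EY * EX).trace := by
          simp only [etr]
          rw [integral_finsetSum _ fun p _ => integrable_finsetSum _ fun q _ => hprod p q]
          simp only [trace, diag_apply, mul_apply]
          refine Finset.sum_congr rfl fun p _ => ?_
          rw [integral_finsetSum _ fun q _ => hprod p q]
          exact Finset.sum_congr rfl fun q _ => (hpq p q).integral_fun_mul_eq_mul_integral
            (hint s p q).aestronglyMeasurable (hinti i q p).aestronglyMeasurable
      _ ≤ EY.trace * K := by
          refine IsSymm.trace_mul_le ?_ (fun v => ?_) fun v => ?_
          · ext p q
            simp only [hEY, transpose_apply, of_apply]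
            refine integral_congr_ae (Filter.Eventually.of_forall fun ω => ?_)
            exact (isSymm_sum hsymm s ω).exp.apply _ _
          · rw [hEY, ← integral_dotProduct_mulVec (hint s)]
            exact integral_nonneg fun ω => (isSymm_sum hsymm s ω).dotProduct_exp_mulVec_nonneg v
          · rw [hEX, ← integral_dotProduct_mulVec (hinti i)]
            exact hexp i v
      _ ≤ Fintype.card ι * K ^ (insert i s).card := by
          rw [Finset.card_insert_of_notMem hi, pow_succ, ← mul_assoc, ← eEY]
          exact mul_le_mul_of_nonneg_right ih hK

end Matrix

/-! ### Scalar bounds on the exponential. -/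

/-- The Padé bound `6 - 2 x ≤ (6 + 4 x + x²) e⁻ˣ`. -/
theorem Real.six_sub_two_mul_le_mul_exp_neg {x : ℝ} (hx : 0 ≤ x) :
    6 - 2 * x ≤ (6 + 4 * x + x ^ 2) * Real.exp (-x) := by
  have hd : ∀ y : ℝ, HasDerivAt (fun y => (6 + 4 * y + y ^ 2) * Real.exp (-y) + 2 * y)
      (2 - (2 + 2 * y + y ^ 2) * Real.exp (-y)) y := fun y => by
    have h1 : HasDerivAt (fun y : ℝ => 6 + 4 * y + y ^ 2) (4 + 2 * y) y := by
      have := (((hasDerivAt_id y).const_mul 4).const_add 6).add (hasDerivAt_pow 2 y)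
      exact this.congr_deriv (by simp)
    have h2 : HasDerivAt (fun y : ℝ => Real.exp (-y)) (-Real.exp (-y)) y := by
      simpa using (hasDerivAt_neg y).exp
    have h3 : HasDerivAt (fun y : ℝ => 2 * y) 2 y := by
      simpa using (hasDerivAt_id y).const_mul 2
    refine ((h1.mul h2).add h3).congr_deriv ?_
    ring
  -- The derivative is nonnegative exactly because `1 + y + y²/2 ≤ eʸ`; the value at `0` is `6`.
  have hmono : MonotoneOn (fun y => (6 + 4 * y + y ^ 2) * Real.exp (-y) + 2 * y) (Set.Ici 0) := by
    refine monotoneOn_of_deriv_nonneg (convex_Ici 0)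
      (fun y _ => (hd y).continuousAt.continuousWithinAt)
      (fun y _ => (hd y).differentiableAt.differentiableWithinAt) fun y hy => ?_
    rw [interior_Ici, Set.mem_Ioi] at hy
    rw [(hd y).deriv]
    have h1 := Real.quadratic_le_exp_of_nonneg hy.le
    have h2 : Real.exp y * Real.exp (-y) = 1 := by rw [← Real.exp_add]; simp
    have h3 := mul_le_mul_of_nonneg_right h1 (Real.exp_pos (-y)).le
    nlinarith
  have := hmono (Set.mem_Ici.2 le_rfl) (Set.mem_Ici.2 hx) hx
  norm_num at this
  linarith

/-- Bernstein's bound on the exponential. -/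
theorem Real.exp_le_one_add_add_mul_sq {x c : ℝ} (hc0 : 0 ≤ c) (hc : c < 3) (hx : x ≤ c) :
    Real.exp x ≤ 1 + x + 1 / (2 * (1 - c / 3)) * x ^ 2 := by
  have hc' : 0 < 1 - c / 3 := by linarith
  rcases le_total x 0 with h | h
  · have hg : (1 : ℝ) / 2 ≤ 1 / (2 * (1 - c / 3)) := by
      apply one_div_le_one_div_of_le <;> linarith
    have h1 := Real.quadratic_le_exp_of_nonneg (neg_nonneg.2 h)
    have h2 : Real.exp x * Real.exp (-x) = 1 := by rw [← Real.exp_add]; simp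
    have h3 : Real.exp x ≤ 1 + x + 1 / 2 * x ^ 2 := by
      -- `(1 + x + x²/2)(1 - x + x²/2) = 1 + x⁴/4`.
      have h4 : 1 ≤ (1 + x + 1 / 2 * x ^ 2) * Real.exp (-x) := by
        nlinarith [mul_le_mul_of_nonneg_left h1 (by nlinarith [sq_nonneg (x + 1)] :
          0 ≤ 1 + x + 1 / 2 * x ^ 2), sq_nonneg (x ^ 2)]
      nlinarith [mul_le_mul_of_nonneg_left h4 (Real.exp_pos x).le]
    nlinarith [mul_le_mul_of_nonneg_right hg (sq_nonneg x)]
  · have hx' : 0 < 1 - x / 3 := by linarith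
    have hg : 1 / (2 * (1 - x / 3)) ≤ 1 / (2 * (1 - c / 3)) := by
      apply one_div_le_one_div_of_le <;> linarith
    have h1 := Real.six_sub_two_mul_le_mul_exp_neg h
    have h2 : Real.exp x * Real.exp (-x) = 1 := by rw [← Real.exp_add]; simp
    have h3 : Real.exp x * (6 - 2 * x) ≤ 6 + 4 * x + x ^ 2 := by
      have := mul_le_mul_of_nonneg_left h1 (Real.exp_pos x).le
      nlinarith
    -- At `c = x` the right side is exactly the Padé quotient, and it only grows with `c`.
    have h4 : Real.exp x ≤ 1 + x + 1 / (2 * (1 - x / 3)) * x ^ 2 := by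
      have : 1 + x + 1 / (2 * (1 - x / 3)) * x ^ 2 = (6 + 4 * x + x ^ 2) / (6 - 2 * x) := by
        have h5 : 3 - x ≠ 0 := by linarith
        have h6 : 6 - 2 * x = 2 * (3 - x) := by ring
        rw [h6]
        field_simp
        ring
      rw [this, le_div_iff₀ (by linarith)]
      exact h3
    nlinarith [mul_le_mul_of_nonneg_right hg (sq_nonneg x)]

/-! ### The matrix and scalar Bernstein inequalities. -/

namespace Matrix

variable {ι : Type*} [Fintype ι] [DecidableEq ι] {Ω : Type*} [MeasurableSpace Ω] {μ : Measure Ω}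
  {κ : Type*} {X : κ → Ω → ι → ι → ℝ}

/-- After integrating the quadratic bound on the exponential, centring kills the linear term and the
variance controls the quadratic one. Then `1 + u ≤ eᵘ` gives a form suited to taking powers. -/
theorem integral_dotProduct_exp_mulVec_le [IsProbabilityMeasure μ] {Y : Ω → ι → ι → ℝ}
    (hY : AEMeasurable Y μ) (hsymm : ∀ ω, (of (Y ω)).IsSymm) {C σ θ : ℝ} (hC0 : 0 ≤ C)
    (hC : ∀ᵐ ω ∂μ, ∀ v, v ⬝ᵥ of (Y ω) *ᵥ v ≤ C * (v ⬝ᵥ v))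
    (hint : ∀ p q, Integrable (fun ω => Y ω p q) μ) (hmean : ∀ p q, ∫ ω, Y ω p q ∂μ = 0)
    (hint2 : ∀ p q, Integrable (fun ω => (of (Y ω) * of (Y ω)) p q) μ)
    (hvar : ∀ v, v ⬝ᵥ (of fun p q => ∫ ω, (of (Y ω) * of (Y ω)) p q ∂μ) *ᵥ v ≤ σ * (v ⬝ᵥ v))
    (hθ : 0 < θ) (hθC : θ * C < 3) (v : ι → ℝ) :
    ∫ ω, v ⬝ᵥ NormedSpace.exp (of (θ • Y ω)) *ᵥ v ∂μ ≤
      Real.exp (1 / (2 * (1 - θ * C / 3)) * θ ^ 2 * σ) * (v ⬝ᵥ v) := by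
  set g := 1 / (2 * (1 - θ * C / 3)) with hg
  have hg0 : 0 ≤ g := by
    rw [hg]
    apply one_div_nonneg.2
    linarith
  have hvv : 0 ≤ v ⬝ᵥ v := by
    rw [dotProduct]
    exact Finset.sum_nonneg fun i _ => mul_self_nonneg _
  have hsm : ∀ ω, (of (θ • Y ω)).IsSymm := fun ω => (hsymm ω).smul θ
  have hCθ : ∀ᵐ ω ∂μ, ∀ v, v ⬝ᵥ of (θ • Y ω) *ᵥ v ≤ (θ * C) * (v ⬝ᵥ v) := by
    filter_upwards [hC] with ω hω v
    rw [← smul_of, smul_mulVec, dotProduct_smul, smul_eq_mul, mul_assoc]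
    exact mul_le_mul_of_nonneg_left (hω v) hθ.le
  have hi1 := integrable_dotProduct_mulVec (integrable_exp_of_apply (hY.const_smul θ) hsm hCθ) v
  have hi2 := integrable_dotProduct_mulVec (A := fun ω => of (Y ω)) hint v
  have hi3 := integrable_dotProduct_mulVec hint2 v
  have hz : ∫ ω, v ⬝ᵥ of (Y ω) *ᵥ v ∂μ = 0 := by
    rw [integral_dotProduct_mulVec (A := fun ω => of (Y ω)) hint v, dotProduct_mulVec_eq_sum]
    simp [hmean]
  have hi4 : Integrable (fun ω => v ⬝ᵥ v + θ * (v ⬝ᵥ of (Y ω) *ᵥ v)) μ :=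
    (integrable_const _).add (hi2.const_mul θ)
  calc ∫ ω, v ⬝ᵥ NormedSpace.exp (of (θ • Y ω)) *ᵥ v ∂μ
      ≤ ∫ ω, (v ⬝ᵥ v + θ * (v ⬝ᵥ of (Y ω) *ᵥ v) +
          (g * θ ^ 2) * (v ⬝ᵥ (of (Y ω) * of (Y ω)) *ᵥ v)) ∂μ := by
        refine integral_mono_ae hi1
          (hi4.add (hi3.const_mul _)) ?_
        filter_upwards [hCθ] with ω hω
        have h := (hsm ω).dotProduct_exp_mulVec_le hω
          (fun x hx => Real.exp_le_one_add_add_mul_sq (by positivity) hθC hx) v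
        rw [← smul_of] at h ⊢
        simp only [smul_mulVec, dotProduct_smul, smul_mul_smul_comm, smul_eq_mul] at h
        refine h.trans_eq ?_
        ring
    _ = v ⬝ᵥ v + g * θ ^ 2 *
        (v ⬝ᵥ (of fun p q => ∫ ω, (of (Y ω) * of (Y ω)) p q ∂μ) *ᵥ v) := by
        rw [integral_add hi4 (hi3.const_mul _),
          integral_add (integrable_const _) (hi2.const_mul θ), integral_const_mul,
          integral_const_mul, hz, integral_dotProduct_mulVec hint2]
        simp
    _ ≤ v ⬝ᵥ v + g * θ ^ 2 * (σ * (v ⬝ᵥ v)) := by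
        have := hvar v
        gcongr
    _ = (g * θ ^ 2 * σ + 1) * (v ⬝ᵥ v) := by ring
    _ ≤ _ := mul_le_mul_of_nonneg_right (Real.add_one_le_exp _) hvv

variable [Fintype κ]

/-- The matrix Chernoff bound under Bernstein conditions. -/
theorem measure_exists_lt_dotProduct_sum_mulVec_le [IsProbabilityMeasure μ]
    (hX : ∀ i, AEMeasurable (X i) μ) (hind : iIndepFun X μ)
    (hsymm : ∀ i ω, (of (X i ω)).IsSymm) {C σ θ : ℝ} (hC0 : 0 ≤ C)
    (hC : ∀ i, ∀ᵐ ω ∂μ, ∀ v, v ⬝ᵥ of (X i ω) *ᵥ v ≤ C * (v ⬝ᵥ v))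
    (hint : ∀ i p q, Integrable (fun ω => X i ω p q) μ) (hmean : ∀ i p q, ∫ ω, X i ω p q ∂μ = 0)
    (hint2 : ∀ i p q, Integrable (fun ω => (of (X i ω) * of (X i ω)) p q) μ)
    (hvar : ∀ i v,
      v ⬝ᵥ (of fun p q => ∫ ω, (of (X i ω) * of (X i ω)) p q ∂μ) *ᵥ v ≤ σ * (v ⬝ᵥ v))
    (hθ : 0 < θ) (hθC : θ * C < 3) (t : ℝ) :
    μ {ω | ∃ v, t * (v ⬝ᵥ v) < ∑ i, v ⬝ᵥ of (X i ω) *ᵥ v} ≤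
      ENNReal.ofReal (Fintype.card ι * Real.exp (Fintype.card κ *
        (1 / (2 * (1 - θ * C / 3)) * θ ^ 2 * σ) - θ * t)) := by
  have hXθ : ∀ i, AEMeasurable (fun ω => θ • X i ω) μ := fun i => (hX i).const_smul θ
  have hindθ : iIndepFun (fun i ω => θ • X i ω) μ :=
    hind.comp (fun _ A => θ • A) fun _ => measurable_const_smul θ
  have hsm : ∀ i ω, (of (θ • X i ω)).IsSymm := fun i ω => (hsymm i ω).smul θ
  have hCθ : ∀ i, ∀ᵐ ω ∂μ, ∀ v, v ⬝ᵥ of (θ • X i ω) *ᵥ v ≤ (θ * C) * (v ⬝ᵥ v) := fun i => by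
    filter_upwards [hC i] with ω hω v
    rw [← smul_of, smul_mulVec, dotProduct_smul, smul_eq_mul, mul_assoc]
    exact mul_le_mul_of_nonneg_left (hω v) hθ.le
  set f : Ω → ℝ := fun ω => (NormedSpace.exp (of ((∑ i, fun ω => θ • X i ω) ω))).trace with hf
  have hfint : Integrable f μ := integrable_finsetSum _ fun p _ =>
    integrable_exp_of_sum_apply hXθ hsm hCθ Finset.univ p p
  have hE := integral_trace_exp_sum_le hXθ hindθ hsm (Real.exp_pos _).le hCθ
    (fun i v => integral_dotProduct_exp_mulVec_le (hX i) (hsymm i) hC0 (hC i) (hint i) (hmean i)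
      (hint2 i) (hvar i) hθ hθC v) Finset.univ
  -- Wherever the form exceeds `t`, the trace exponential `f` is at least `exp (θ * t)`.
  have hmarkov := mul_meas_ge_le_integral_of_nonneg (μ := μ) (f := f)
    (Filter.Eventually.of_forall fun ω => (isSymm_sum hsm _ ω).trace_exp_nonneg) hfint
    (Real.exp (θ * t))
  refine (measure_mono (t := {ω | Real.exp (θ * t) ≤ f ω}) ?_).trans ?_
  · rintro ω ⟨v, hv⟩
    refine (isSymm_sum hsm _ ω).exp_le_trace_exp (v := v) ?_
    rw [dotProduct_sum_mulVec]
    simp only [← smul_of, smul_mulVec, dotProduct_smul, ← Finset.smul_sum]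
    rw [smul_eq_mul, mul_assoc]
    exact mul_lt_mul_of_pos_left hv hθ
  · rw [← ofReal_measureReal]
    refine ENNReal.ofReal_le_ofReal ?_
    rw [Real.exp_sub, ← mul_div_assoc, le_div_iff₀ (Real.exp_pos _), mul_comm, Real.exp_nat_mul]
    exact hmarkov.trans hE

/-- **Matrix Bernstein inequality**, for variance bounds `γ ^ 2 > 0`. -/
theorem measure_exists_bernsteinTerm_lt_le_of_pos [IsProbabilityMeasure μ] [Nonempty κ]
    (hX : ∀ i, AEMeasurable (X i) μ) (hind : iIndepFun X μ)
    (hsymm : ∀ i ω, (of (X i ω)).IsSymm) {C γ δ : ℝ} (hC0 : 0 ≤ C)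
    (hC : ∀ i, ∀ᵐ ω ∂μ, ∀ v, v ⬝ᵥ of (X i ω) *ᵥ v ≤ C * (v ⬝ᵥ v))
    (hint : ∀ i p q, Integrable (fun ω => X i ω p q) μ) (hmean : ∀ i p q, ∫ ω, X i ω p q ∂μ = 0)
    (hint2 : ∀ i p q, Integrable (fun ω => (of (X i ω) * of (X i ω)) p q) μ)
    (hvar : ∀ i v,
      v ⬝ᵥ (of fun p q => ∫ ω, (of (X i ω) * of (X i ω)) p q ∂μ) *ᵥ v ≤ γ ^ 2 * (v ⬝ᵥ v))
    (hδ : 0 < δ) (hδ1 : δ < Fintype.card ι) (hγ : 0 < γ) :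
    μ {ω | ∃ v, Fintype.card κ * bernsteinTerm C γ (Fintype.card κ) (Fintype.card ι) δ *
      (v ⬝ᵥ v) < ∑ i, v ⬝ᵥ of (X i ω) *ᵥ v} ≤ ENNReal.ofReal δ := by
  set D : ℝ := (Fintype.card ι : ℝ) with hD
  set M : ℝ := (Fintype.card κ : ℝ) with hM
  have hM0 : 0 < M := by rw [hM]; exact_mod_cast Fintype.card_pos
  set l := Real.log (D / δ) with hl
  have hl0 : 0 < l := Real.log_pos ((one_lt_div hδ).2 hδ1)
  set t := M * bernsteinTerm C γ M D δ with ht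
  set b := Real.sqrt (2 * γ ^ 2 * M * l) with hb
  have hb0 : 0 < b := Real.sqrt_pos.2 (by positivity)
  have hbsq : b ^ 2 = 2 * γ ^ 2 * M * l := Real.sq_sqrt (by positivity)
  have htb : t = 2 * C * l / 3 + b := by
    have h1 : M * Real.sqrt (2 * γ ^ 2 / M * l) = b := by
      rw [hb, ← Real.sqrt_sq hM0.le, ← Real.sqrt_mul (sq_nonneg _), Real.sqrt_sq hM0.le]
      congr 1
      field_simp
    rw [ht, bernsteinTerm, mul_add, h1]
    congr 1
    rw [← hl]
    field_simp
  have ht0 : 0 < t := by rw [htb]; positivity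
  have hs0 : 0 < M * γ ^ 2 + C * t / 3 := by positivity
  -- The classical Bernstein choice: it makes `1 - θC/3 = Mγ² / (Mγ² + Ct/3)`, and the exponent
  -- becomes `-t² / (2(Mγ² + Ct/3))`.
  set θ := t / (M * γ ^ 2 + C * t / 3) with hθ
  have hθ0 : 0 < θ := by positivity
  have hθC : θ * C < 3 := by
    rw [hθ, div_mul_eq_mul_div, div_lt_iff₀ hs0]
    nlinarith [show 0 < M * γ ^ 2 by positivity]
  refine (measure_exists_lt_dotProduct_sum_mulVec_le hX hind hsymm hC0 hC hint hmean hint2 hvar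
    hθ0 hθC t).trans (ENNReal.ofReal_le_ofReal ?_)
  have h1 : 1 - θ * C / 3 = M * γ ^ 2 / (M * γ ^ 2 + C * t / 3) := by
    rw [hθ]
    field_simp
    ring
  have h2 : M * (1 / (2 * (1 - θ * C / 3)) * θ ^ 2 * γ ^ 2) - θ * t =
      -(t ^ 2 / (2 * (M * γ ^ 2 + C * t / 3))) := by
    rw [h1, hθ]
    field_simp
    ring
  -- With `t = 2Cl/3 + b` and `b² = 2γ²Ml`, one has `t² = (2Cl/3)t + bt ≥ (2Cl/3)t + b²`, which is
  -- `2l(Ct/3 + Mγ²)`.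
  have h3 : l ≤ t ^ 2 / (2 * (M * γ ^ 2 + C * t / 3)) := by
    rw [le_div_iff₀ (by positivity)]
    have h4 : t ^ 2 = 2 * C * l / 3 * t + b * t := by
      rw [sq]; nth_rewrite 1 [htb]; ring
    have h5 : b ^ 2 ≤ b * t := by
      rw [sq]
      refine mul_le_mul_of_nonneg_left ?_ hb0.le
      rw [htb]
      linarith [show 0 ≤ 2 * C * l / 3 by positivity]
    nlinarith
  calc D * Real.exp (M * (1 / (2 * (1 - θ * C / 3)) * θ ^ 2 * γ ^ 2) - θ * t)
      ≤ D * Real.exp (-l) := by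
        rw [h2]
        gcongr
    _ = δ := by
        have hD0 : 0 < D := hδ.trans hδ1
        rw [hl, ← Real.log_inv, Real.exp_log (by positivity)]
        field_simp

/-- **Matrix Bernstein inequality**. -/
theorem measure_exists_bernsteinTerm_lt_le [IsProbabilityMeasure μ] [Nonempty κ]
    (hX : ∀ i, AEMeasurable (X i) μ) (hind : iIndepFun X μ)
    (hsymm : ∀ i ω, (of (X i ω)).IsSymm) {C γ δ : ℝ} (hC0 : 0 ≤ C)
    (hC : ∀ i, ∀ᵐ ω ∂μ, ∀ v, v ⬝ᵥ of (X i ω) *ᵥ v ≤ C * (v ⬝ᵥ v))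
    (hint : ∀ i p q, Integrable (fun ω => X i ω p q) μ) (hmean : ∀ i p q, ∫ ω, X i ω p q ∂μ = 0)
    (hint2 : ∀ i p q, Integrable (fun ω => (of (X i ω) * of (X i ω)) p q) μ)
    (hvar : ∀ i v,
      v ⬝ᵥ (of fun p q => ∫ ω, (of (X i ω) * of (X i ω)) p q ∂μ) *ᵥ v ≤ γ ^ 2 * (v ⬝ᵥ v))
    (hδ : 0 < δ) (hδ1 : δ < Fintype.card ι) :
    μ {ω | ∃ v, Fintype.card κ * bernsteinTerm C γ (Fintype.card κ) (Fintype.card ι) δ *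
      (v ⬝ᵥ v) < ∑ i, v ⬝ᵥ of (X i ω) *ᵥ v} ≤ ENNReal.ofReal δ := by
  set D : ℝ := (Fintype.card ι : ℝ) with hD
  set M : ℝ := (Fintype.card κ : ℝ) with hM
  have hl0 : 0 < Real.log (D / δ) := Real.log_pos ((one_lt_div hδ).2 hδ1)
  have hvv : ∀ v : ι → ℝ, 0 ≤ v ⬝ᵥ v := fun v => by
    rw [dotProduct]
    exact Finset.sum_nonneg fun i _ => mul_self_nonneg _
  -- The degenerate case `γ = 0` is reached by a limit of positive variance bounds decreasing to `γ
  -- ^ 2`.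
  set γ' : ℕ → ℝ := fun n => Real.sqrt (γ ^ 2 + 1 / ((n : ℝ) + 1)) with hγ'
  have hγ'0 : ∀ n, 0 < γ' n := fun n => Real.sqrt_pos.2 (by positivity)
  have hγ'sq : ∀ n, γ' n ^ 2 = γ ^ 2 + 1 / ((n : ℝ) + 1) := fun n => Real.sq_sqrt (by positivity)
  set E : ℝ → Set Ω := fun u => {ω | ∃ v, M * u * (v ⬝ᵥ v) < ∑ i, v ⬝ᵥ of (X i ω) *ᵥ v} with hE
  have hEanti : Antitone E := fun u u' huu' ω ⟨v, hv⟩ => ⟨v, lt_of_le_of_lt (by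
    have := hvv v
    gcongr) hv⟩
  have hmono : Monotone fun n => E (bernsteinTerm C (γ' n) M D δ) := fun n n' hnn' => by
    refine hEanti ?_
    simp only [bernsteinTerm, hγ'sq]
    gcongr
  have hlim : Filter.Tendsto (fun n => bernsteinTerm C (γ' n) M D δ) Filter.atTop
      (nhds (bernsteinTerm C γ M D δ)) := by
    simp only [bernsteinTerm, hγ'sq]
    have h1 : Filter.Tendsto (fun n : ℕ => γ ^ 2 + 1 / ((n : ℝ) + 1)) Filter.atTop
        (nhds (γ ^ 2)) := by
      simpa using tendsto_one_div_add_atTop_nhds_zero_nat.const_add (γ ^ 2)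
    exact ((((h1.const_mul 2).div_const M).mul_const _).sqrt).const_add _
  -- A strict inequality survives a small increase of the threshold, so the increasing events of the
  -- approximations cover the limiting one.
  have hsub : E (bernsteinTerm C γ M D δ) ⊆ ⋃ n, E (bernsteinTerm C (γ' n) M D δ) := by
    rintro ω ⟨v, hv⟩
    have h1 := ((hlim.const_mul M).mul_const (v ⬝ᵥ v)).eventually_lt_const hv
    obtain ⟨n, hn⟩ := h1.exists
    exact Set.mem_iUnion.2 ⟨n, v, hn⟩
  refine (measure_mono hsub).trans ?_
  rw [hmono.measure_iUnion]
  refine iSup_le fun n => measure_exists_bernsteinTerm_lt_le_of_pos hX hind hsymm hC0 hC hint hmean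
    hint2 (fun i v => (hvar i v).trans ?_) hδ hδ1 (hγ'0 n)
  rw [hγ'sq]
  exact mul_le_mul_of_nonneg_right (by simp; positivity) (hvv v)

end Matrix

/-- One-sided **Bernstein inequality**. -/
theorem measure_bernsteinTerm_lt_sum_le {Ω : Type*} [MeasurableSpace Ω] {μ : Measure Ω}
    [IsProbabilityMeasure μ] {κ : Type*} [Fintype κ] [Nonempty κ] {Y : κ → Ω → ℝ}
    (hY : ∀ i, AEMeasurable (Y i) μ) (hind : iIndepFun Y μ) {C γ δ : ℝ}
    (hC : ∀ i, ∀ᵐ ω ∂μ, |Y i ω| ≤ C) (hmean : ∀ i, ∫ ω, Y i ω ∂μ = 0)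
    (hvar : ∀ i, ∫ ω, Y i ω ^ 2 ∂μ ≤ γ ^ 2) (hδ : 0 < δ) (hδ1 : δ < 1) :
    μ {ω | Fintype.card κ * bernsteinTerm C γ (Fintype.card κ) 1 δ < ∑ i, Y i ω} ≤
      ENNReal.ofReal δ := by
  have hC0 : 0 ≤ C := by
    obtain ⟨ω, hω⟩ := (hC (Classical.arbitrary κ)).exists
    exact (abs_nonneg _).trans hω
  have hint2 : ∀ i, Integrable (fun ω => Y i ω * Y i ω) μ := fun i => by
    refine Integrable.of_bound ((hY i).mul (hY i)).aestronglyMeasurable (C * C) ?_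
    filter_upwards [hC i] with ω hω
    rw [norm_mul]
    exact mul_le_mul hω hω (norm_nonneg _) hC0
  -- A real variable is a `1 × 1` matrix, so the dimension factor is `1`.
  have h := Matrix.measure_exists_bernsteinTerm_lt_le (ι := Unit) (μ := μ) (γ := γ) (δ := δ)
    (X := fun i ω _ _ => Y i ω)
    (fun i => aemeasurable_pi_lambda _ fun _ => aemeasurable_pi_lambda _ fun _ => hY i)
    (hind.comp (γ := fun _ => Unit → Unit → ℝ) (fun _ y _ _ => y) fun _ => by fun_prop) (fun i ω => by ext; simp) hC0
    (fun i => by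
      filter_upwards [hC i] with ω hω v
      rw [Matrix.dotProduct_mulVec_eq_sum]
      simp only [Finset.univ_unique, Finset.sum_singleton, dotProduct, Matrix.of_apply]
      nlinarith [mul_self_nonneg (v default), (abs_le.1 hω).2])
    (fun i _ _ => Integrable.of_bound (hY i).aestronglyMeasurable C (hC i)) (fun i _ _ => hmean i)
    (fun i _ _ => by simpa [Matrix.mul_apply] using hint2 i)
    (fun i v => by
      rw [Matrix.dotProduct_mulVec_eq_sum]
      have := hvar i
      simp only [Finset.univ_unique, Finset.sum_singleton, dotProduct, Matrix.of_apply,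
        Matrix.mul_apply, ← sq] at this ⊢
      nlinarith [sq_nonneg (v default)]) hδ (by simpa using hδ1)
  refine (measure_mono fun ω hω => ?_).trans h
  refine ⟨fun _ => 1, ?_⟩
  simpa [Matrix.mulVec, dotProduct] using hω

/-! ### Bernstein inequalities on product measures. -/

open scoped Matrix

section Product

variable {E : Type*} [MeasurableSpace E] {P : Measure E} [IsProbabilityMeasure P]
  {κ : Type*} [Fintype κ]

theorem MeasureTheory.Measure.ae_pi_eval {p : E → Prop} (h : ∀ᵐ s ∂P, p s) (i : κ) :
    ∀ᵐ t ∂Measure.pi (fun _ : κ => P), p (t i) :=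
  (Measure.quasiMeasurePreserving_eval (fun _ : κ => P) i).ae h

theorem MeasureTheory.Integrable.pi_eval {f : E → ℝ} (h : Integrable f P) (i : κ) :
    Integrable (fun t => f (t i)) (Measure.pi fun _ : κ => P) :=
  (measurePreserving_eval (fun _ : κ => P) i).integrable_comp_of_integrable h

/-- The matrix Bernstein inequality for an i.i.d. sample. -/
theorem Matrix.pi_exists_bernsteinTerm_lt_le [Nonempty κ] {ι : Type*} [Fintype ι] [DecidableEq ι]
    {Y : E → ι → ι → ℝ} (hsymm : ∀ s, (of (Y s)).IsSymm) {C γ δ : ℝ} (hC0 : 0 ≤ C)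
    (hC : ∀ᵐ s ∂P, ∀ v, v ⬝ᵥ of (Y s) *ᵥ v ≤ C * (v ⬝ᵥ v))
    (hint : ∀ p q, Integrable (fun s => Y s p q) P) (hmean : ∀ p q, ∫ s, Y s p q ∂P = 0)
    (hint2 : ∀ p q, Integrable (fun s => (of (Y s) * of (Y s)) p q) P)
    (hvar : ∀ v,
      v ⬝ᵥ (of fun p q => ∫ s, (of (Y s) * of (Y s)) p q ∂P) *ᵥ v ≤ γ ^ 2 * (v ⬝ᵥ v))
    (hδ : 0 < δ) (hδ1 : δ < Fintype.card ι) :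
    Measure.pi (fun _ : κ => P) {t : κ → E | ∃ v, Fintype.card κ *
      bernsteinTerm C γ (Fintype.card κ) (Fintype.card ι) δ *
      (v ⬝ᵥ v) < ∑ i, v ⬝ᵥ of (Y (t i)) *ᵥ v} ≤ ENNReal.ofReal δ := by
  have hY : AEMeasurable Y P := aemeasurable_pi_lambda _ fun p => aemeasurable_pi_lambda _ fun q =>
    (hint p q).aestronglyMeasurable.aemeasurable
  refine Matrix.measure_exists_bernsteinTerm_lt_le (X := fun i (t : κ → E) => Y (t i))
    (fun i => hY.comp_quasiMeasurePreserving (Measure.quasiMeasurePreserving_eval _ i))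
    (iIndepFun_pi fun _ => hY) (fun i t => hsymm (t i)) hC0
    (fun i => Measure.ae_pi_eval hC i) (fun i p q => (hint p q).pi_eval i)
    (fun i p q => ?_) (fun i p q => (hint2 p q).pi_eval i) (fun i v => ?_) hδ hδ1
  · rw [← hmean p q]
    exact integral_comp_eval (μ := fun _ : κ => P) (hint p q).aestronglyMeasurable
  · have h : ∀ p q, ∫ t : κ → E, (of (Y (t i)) * of (Y (t i))) p q ∂Measure.pi (fun _ => P) =
        ∫ s, (of (Y s) * of (Y s)) p q ∂P := fun p q =>
      integral_comp_eval (μ := fun _ : κ => P) (f := fun s => (of (Y s) * of (Y s)) p q)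
        (hint2 p q).aestronglyMeasurable
    simp only [h]
    exact hvar v

/-- The one-sided Bernstein inequality for an i.i.d. sample. -/
theorem pi_bernsteinTerm_lt_sum_le [Nonempty κ] {Y : E → ℝ} (hint : Integrable Y P) {C γ δ : ℝ}
    (hC : ∀ᵐ s ∂P, |Y s| ≤ C) (hmean : ∫ s, Y s ∂P = 0)
    (hvar : ∫ s, Y s ^ 2 ∂P ≤ γ ^ 2) (hδ : 0 < δ) (hδ1 : δ < 1) :
    Measure.pi (fun _ : κ => P)
      {t : κ → E | Fintype.card κ * bernsteinTerm C γ (Fintype.card κ) 1 δ < ∑ i, Y (t i)} ≤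
      ENNReal.ofReal δ := by
  have hY : AEMeasurable Y P := hint.aestronglyMeasurable.aemeasurable
  refine measure_bernsteinTerm_lt_sum_le (Y := fun i (t : κ → E) => Y (t i))
    (fun i => hY.comp_quasiMeasurePreserving (Measure.quasiMeasurePreserving_eval _ i))
    (iIndepFun_pi fun _ => hY) (fun i => Measure.ae_pi_eval hC i)
    (fun i => ?_) (fun i => ?_) hδ hδ1
  · rw [← hmean]
    exact integral_comp_eval (μ := fun _ : κ => P) hint.aestronglyMeasurable
  · refine le_trans (le_of_eq ?_) hvar
    exact integral_comp_eval (μ := fun _ : κ => P) (f := fun s => Y s ^ 2)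
      (hY.pow_const 2).aestronglyMeasurable

end Product

/-! ### Eigenvalue and norm bounds, rescaling of `δ`, and conditioning on independent data. -/

theorem Matrix.IsSymm.dotProduct_mulVec_le_lambdaMax {ι : Type} [Fintype ι] [DecidableEq ι]
    {A : Matrix ι ι ℝ} (hA : A.IsSymm) (v : ι → ℝ) :
    v ⬝ᵥ A *ᵥ v ≤ lambdaMax A * (v ⬝ᵥ v) := by
  have hbdd : BddAbove (spectrum ℝ A) := (Matrix.finite_real_spectrum (A := A)).bddAbove
  obtain ⟨U, d, h1, h2, hd, hs⟩ := hA.exists_eq_mul_diagonal_mul_transpose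
  rw [← sum_transpose_mulVec_sq h1, Finset.mul_sum]
  nth_rewrite 1 [hd]
  rw [dotProduct_mul_diagonal_mul_transpose_mulVec]
  exact Finset.sum_le_sum fun i _ =>
    mul_le_mul_of_nonneg_right (le_csSup hbdd (hs i)) (sq_nonneg _)

theorem Matrix.dotProduct_mulVec_le_spectralNorm₂ {ι : Type} [Fintype ι] [DecidableEq ι]
    (A : Matrix ι ι ℝ) (v : ι → ℝ) : v ⬝ᵥ A *ᵥ v ≤ spectralNorm₂ A * (v ⬝ᵥ v) := by
  set x : EuclideanSpace ℝ ι := WithLp.toLp 2 v with hx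
  have h1 : v ⬝ᵥ A *ᵥ v = inner ℝ x (Matrix.toEuclideanCLM (n := ι) (𝕜 := ℝ) A x) := by
    rw [EuclideanSpace.inner_eq_star_dotProduct]
    simp [hx, dotProduct_comm]
  have h2 : v ⬝ᵥ v = ‖x‖ ^ 2 := by
    rw [EuclideanSpace.real_norm_sq_eq]
    simp [hx, dotProduct, sq]
  rw [h1, h2]
  refine (real_inner_le_norm _ _).trans ?_
  calc ‖x‖ * ‖Matrix.toEuclideanCLM (n := ι) (𝕜 := ℝ) A x‖
      ≤ ‖x‖ * (spectralNorm₂ A * ‖x‖) := by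
        gcongr
        exact ContinuousLinearMap.le_opNorm _ _
    _ = _ := by ring

/-- Constants inside the logarithm come from union bounds: they amount to a smaller failure
probability. -/
theorem bernsteinTerm_mul_eq (C γ M D δ : ℝ) {c : ℝ} (hc : c ≠ 0) :
    bernsteinTerm C γ M (c * D) δ = bernsteinTerm C γ M D (δ / c) := by
  have : c * D / δ = D / (δ / c) := by
    field_simp
  simp only [bernsteinTerm, this]

/-- Under independence the joint law is a product, so the constant kernel disintegrates it;
disintegrations are unique almost everywhere. -/
theorem ProbabilityTheory.IndepFun.condDistrib_ae_eq {Ω α β : Type*} [MeasurableSpace Ω]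
    [MeasurableSpace α] [MeasurableSpace β] [StandardBorelSpace β] [Nonempty β]
    {μ : Measure Ω} [IsProbabilityMeasure μ] {X : Ω → α} {Y : Ω → β} (h : IndepFun X Y μ)
    (hX : Measurable X) (hY : Measurable Y) :
    ∀ᵐ a ∂μ.map X, condDistrib Y X μ a = μ.map Y := by
  have : IsProbabilityMeasure (μ.map Y) := Measure.isProbabilityMeasure_map hY.aemeasurable
  have h1 := condDistrib_ae_eq_of_measure_eq_compProd (μ := μ) X hY.aemeasurable
    (κ := Kernel.const α (μ.map Y)) (by
      rw [Measure.compProd_const]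
      exact (indepFun_iff_map_prod_eq_prod_map_map hX.aemeasurable hY.aemeasurable).1 h)
  filter_upwards [h1] with a ha
  rw [ha, Kernel.const_apply]

/-! ### Integrability and centring of `G`, `V` and `c_y`. -/

namespace Architecture

variable {N : Architecture} {P : Measure N.Example} {wσ : N.Weights}
  {Czz γzz Cyz γyz Cy γy : ℝ}

theorem devG_isSymm (P : Measure N.Example) (wσ : N.Weights) (s : N.Example) :
    (N.devG P wσ s).IsSymm := by
  ext p q
  simp [devG, mul_comm]

namespace BoundedVariance

theorem memLp_feature_mul (h : N.BoundedVariance P wσ Czz γzz Cyz γyz Cy γy) (p q : N.Path) :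
    MemLp (fun s : N.Example => N.feature wσ s.1 p * N.feature wσ s.1 q) 2 P := by
  have : ENNReal.HolderTriple 4 4 2 := ⟨by
    rw [← ENNReal.toReal_eq_toReal_iff' (by simp) (by simp), ENNReal.toReal_add (by simp) (by simp)]
    norm_num⟩
  exact (h.moment q).mul' (h.moment p)

variable [IsProbabilityMeasure P]

theorem memLp_devG (h : N.BoundedVariance P wσ Czz γzz Cyz γyz Cy γy) (p q : N.Path) :
    MemLp (fun s => N.devG P wσ s p q) 2 P :=
  (memLp_const _).sub (h.memLp_feature_mul p q)

theorem integrable_feature_mul (h : N.BoundedVariance P wσ Czz γzz Cyz γyz Cy γy) (p q : N.Path) :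
    Integrable (fun s : N.Example => N.feature wσ s.1 p * N.feature wσ s.1 q) P :=
  (h.memLp_feature_mul p q).integrable (by norm_num)

theorem integrable_devG (h : N.BoundedVariance P wσ Czz γzz Cyz γyz Cy γy) (p q : N.Path) :
    Integrable (fun s => N.devG P wσ s p q) P :=
  (h.memLp_devG p q).integrable (by norm_num)

theorem integral_devG (h : N.BoundedVariance P wσ Czz γzz Cyz γyz Cy γy) (p q : N.Path) :
    ∫ s, N.devG P wσ s p q ∂P = 0 := by
  simp only [devG, Matrix.of_apply]
  rw [integral_sub (integrable_const _) (h.integrable_feature_mul p q)]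
  simp

theorem integrable_devG_mul_devG (h : N.BoundedVariance P wσ Czz γzz Cyz γyz Cy γy)
    (p q : N.Path) : Integrable (fun s => (N.devG P wσ s * N.devG P wσ s) p q) P := by
  simp only [Matrix.mul_apply]
  exact integrable_finsetSum _ fun r _ => (h.memLp_devG p r).integrable_mul (h.memLp_devG r q)

/-- A diagonal entry of `G` has mean zero and is at most `λ_max(G)`. -/
theorem zz_nonneg (h : N.BoundedVariance P wσ Czz γzz Cyz γyz Cy γy) [Nonempty N.Path] :
    0 ≤ Czz := by
  let p := Classical.arbitrary N.Path
  rw [← h.integral_devG p p]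
  refine (integral_mono_ae (h.integrable_devG p p) (integrable_const Czz) ?_).trans_eq (by simp)
  filter_upwards [h.bound_zz] with s hs
  refine le_trans ?_ hs
  simpa using (devG_isSymm P wσ s).dotProduct_mulVec_le_lambdaMax (Pi.single p 1)

/-- The integral inside `devV` is a fixed real number, with default value `0` if it diverged. The
bound on `V` therefore already bounds `y_k z̃_p` almost surely, which gives integrability. -/
theorem integrable_mul_feature (h : N.BoundedVariance P wσ Czz γzz Cyz γyz Cy γy)
    (k : Fin N.dy) (p : N.Path) :
    Integrable (fun s : N.Example => s.2 k * N.feature wσ s.1 p) P := by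
  have hm : Measurable fun s : N.Example => s.2 k := by fun_prop
  refine Integrable.of_bound (hm.aestronglyMeasurable.mul (h.moment p).1)
    (Cyz + |∫ r, r.2 k * N.feature wσ r.1 p ∂P|) ?_
  filter_upwards [h.bound_yz] with s hs
  have h1 := hs k p
  rw [devV] at h1
  rw [Real.norm_eq_abs]
  linarith [abs_sub_abs_le_abs_sub (s.2 k * N.feature wσ s.1 p)
    (∫ r, r.2 k * N.feature wσ r.1 p ∂P)]

theorem integrable_devV (h : N.BoundedVariance P wσ Czz γzz Cyz γyz Cy γy)
    (k : Fin N.dy) (p : N.Path) : Integrable (fun s => N.devV P wσ s k p) P :=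
  (h.integrable_mul_feature k p).sub (integrable_const _)

theorem integral_devV (h : N.BoundedVariance P wσ Czz γzz Cyz γyz Cy γy)
    (k : Fin N.dy) (p : N.Path) : ∫ s, N.devV P wσ s k p ∂P = 0 := by
  simp only [devV]
  rw [integral_sub (h.integrable_mul_feature k p) (integrable_const _)]
  simp

theorem integrable_sum_sq (h : N.BoundedVariance P wσ Czz γzz Cyz γyz Cy γy) :
    Integrable (fun s : N.Example => ∑ k, s.2 k ^ 2) P := by
  have hm : Measurable fun s : N.Example => ∑ k, s.2 k ^ 2 := by fun_prop
  refine Integrable.of_bound hm.aestronglyMeasurable (Cy + |∫ r : N.Example, ∑ k, r.2 k ^ 2 ∂P|) ?_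
  filter_upwards [h.bound_y] with s hs
  rw [devY, abs_sub_comm] at hs
  rw [Real.norm_eq_abs]
  linarith [abs_sub_abs_le_abs_sub (∑ k, s.2 k ^ 2) (∫ r : N.Example, ∑ k, r.2 k ^ 2 ∂P)]

theorem integrable_devY (h : N.BoundedVariance P wσ Czz γzz Cyz γyz Cy γy) :
    Integrable (fun s => N.devY P s) P :=
  (integrable_const _).sub h.integrable_sum_sq

theorem integral_devY (h : N.BoundedVariance P wσ Czz γzz Cyz γyz Cy γy) :
    ∫ s, N.devY P s ∂P = 0 := by
  simp only [devY]
  rw [integral_sub (integrable_const _) h.integrable_sum_sq]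
  simp

/-! ### Tail bounds for the three sample averages, each at level `δ/3`. -/

variable {κ : Type} [Fintype κ] [Nonempty κ] {δ : ℝ}

theorem measure_devG_le (h : N.BoundedVariance P wσ Czz γzz Cyz γyz Cy γy) (hδ : 0 < δ)
    (hδ1 : δ < 1) : Measure.pi (fun _ : κ => P) {t : κ → N.Example | ∃ v, Fintype.card κ *
      bernsteinTerm Czz γzz (Fintype.card κ) (3 * N.dz) δ * (v ⬝ᵥ v) <
        ∑ i, v ⬝ᵥ N.devG P wσ (t i) *ᵥ v} ≤ ENNReal.ofReal (δ / 3) := by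
  cases isEmpty_or_nonempty N.Path
  · simp
  rw [bernsteinTerm_mul_eq _ _ _ _ _ three_ne_zero]
  refine Matrix.pi_exists_bernsteinTerm_lt_le (Y := fun s => N.devG P wσ s) (devG_isSymm P wσ)
    h.zz_nonneg ?_ h.integrable_devG h.integral_devG h.integrable_devG_mul_devG (fun v => ?_)
    (by positivity) ?_
  · filter_upwards [h.bound_zz] with s hs v
    refine ((devG_isSymm P wσ s).dotProduct_mulVec_le_lambdaMax v).trans ?_
    exact mul_le_mul_of_nonneg_right hs (by simpa using dotProduct_star_self_nonneg v)
  · refine (Matrix.dotProduct_mulVec_le_spectralNorm₂ _ v).trans ?_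
    exact mul_le_mul_of_nonneg_right h.var_zz (by simpa using dotProduct_star_self_nonneg v)
  · have : (1 : ℝ) ≤ Fintype.card N.Path := by exact_mod_cast Fintype.card_pos
    linarith

theorem measure_devV_le (h : N.BoundedVariance P wσ Czz γzz Cyz γyz Cy γy) (hδ : 0 < δ)
    (hδ1 : δ < 1) : Measure.pi (fun _ : κ => P) {t : κ → N.Example | ∃ k p, Fintype.card κ *
      bernsteinTerm Cyz γyz (Fintype.card κ) (6 * N.dy * N.dz) δ <
        |∑ i, N.devV P wσ (t i) k p|} ≤ ENNReal.ofReal (δ / 3) := by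
  cases isEmpty_or_nonempty (Fin N.dy × N.Path) with
  | inl he =>
    have : {t : κ → N.Example | ∃ k p, Fintype.card κ *
      bernsteinTerm Cyz γyz (Fintype.card κ) (6 * N.dy * N.dz) δ <
        |∑ i, N.devV P wσ (t i) k p|} = ∅ :=
      Set.eq_empty_of_forall_notMem fun t ⟨k, p, _⟩ => he.elim (k, p)
    rw [this]
    simp
  | inr hne =>
    have hc : (1 : ℝ) ≤ Fintype.card (Fin N.dy × N.Path) := by exact_mod_cast Fintype.card_pos
    have hcard : (N.dy : ℝ) * N.dz = Fintype.card (Fin N.dy × N.Path) := by simp [dz]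
    set c : ℝ := (Fintype.card (Fin N.dy × N.Path) : ℝ) with hcdef
    set B := Fintype.card κ * bernsteinTerm Cyz γyz (Fintype.card κ) (6 * N.dy * N.dz) δ with hB
    -- There are `c` entries with two signs each, so level `δ / (6 * c)` for each of the `2 * c`
    -- events adds up to `δ / 3`.
    have hB' : B = Fintype.card κ * bernsteinTerm Cyz γyz (Fintype.card κ) 1 (δ / (6 * c)) := by
      rw [hB, ← bernsteinTerm_mul_eq _ _ _ _ _ (by positivity), mul_one, mul_assoc, hcard]
    have hδc : 0 < δ / (6 * c) := by positivity
    have hδc1 : δ / (6 * c) < 1 := (div_lt_one (by positivity)).2 (by linarith)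
    have hpos : ∀ kp : Fin N.dy × N.Path, Measure.pi (fun _ : κ => P)
        {t : κ → N.Example | B < ∑ i, N.devV P wσ (t i) kp.1 kp.2} ≤
          ENNReal.ofReal (δ / (6 * c)) := fun kp => by
      rw [hB']
      refine pi_bernsteinTerm_lt_sum_le (h.integrable_devV kp.1 kp.2) ?_ (h.integral_devV _ _)
        (h.var_yz _ _) hδc hδc1
      filter_upwards [h.bound_yz] with s hs using hs _ _
    have hneg : ∀ kp : Fin N.dy × N.Path, Measure.pi (fun _ : κ => P)
        {t : κ → N.Example | B < ∑ i, -N.devV P wσ (t i) kp.1 kp.2} ≤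
          ENNReal.ofReal (δ / (6 * c)) := fun kp => by
      rw [hB']
      refine pi_bernsteinTerm_lt_sum_le (Y := fun s => -N.devV P wσ s kp.1 kp.2)
        (h.integrable_devV kp.1 kp.2).neg ?_ ?_ ?_ hδc hδc1
      · filter_upwards [h.bound_yz] with s hs
        rw [abs_neg]
        exact hs _ _
      · rw [integral_neg, h.integral_devV, neg_zero]
      · simpa only [neg_sq] using h.var_yz kp.1 kp.2
    calc _ ≤ Measure.pi (fun _ : κ => P) (⋃ kp : Fin N.dy × N.Path,
          ({t : κ → N.Example | B < ∑ i, N.devV P wσ (t i) kp.1 kp.2} ∪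
            {t : κ → N.Example | B < ∑ i, -N.devV P wσ (t i) kp.1 kp.2})) := by
          refine measure_mono ?_
          rintro t ⟨k, p, ht⟩
          refine Set.mem_iUnion.2 ⟨(k, p), ?_⟩
          rcases lt_abs.1 ht with ht | ht
          · exact Or.inl ht
          · exact Or.inr (by simpa only [Set.mem_ofPred_eq, Finset.sum_neg_distrib] using ht)
      _ ≤ ∑ _kp : Fin N.dy × N.Path, ENNReal.ofReal (2 * (δ / (6 * c))) := by
          refine (measure_iUnion_fintype_le _ _).trans (Finset.sum_le_sum fun kp _ => ?_)
          refine (measure_union_le _ _).trans ((add_le_add (hpos kp) (hneg kp)).trans_eq ?_)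
          rw [← ENNReal.ofReal_add hδc.le hδc.le, two_mul]
      _ = ENNReal.ofReal (δ / 3) := by
          rw [← ENNReal.ofReal_sum_of_nonneg fun _ _ => by positivity]
          congr 1
          rw [Finset.sum_const, Finset.card_univ, nsmul_eq_mul, ← hcdef]
          field_simp
          norm_num

theorem measure_devY_le (h : N.BoundedVariance P wσ Czz γzz Cyz γyz Cy γy) (hδ : 0 < δ)
    (hδ1 : δ < 1) : Measure.pi (fun _ : κ => P) {t : κ → N.Example | Fintype.card κ *
      bernsteinTerm Cy γy (Fintype.card κ) 3 δ < ∑ i, N.devY P (t i)} ≤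
        ENNReal.ofReal (δ / 3) := by
  have := bernsteinTerm_mul_eq Cy γy (Fintype.card κ) 1 δ three_ne_zero
  rw [mul_one] at this
  rw [this]
  exact pi_bernsteinTerm_lt_sum_le h.integrable_devY h.bound_y h.integral_devY h.var_y
    (by positivity) (by linarith)

/-! ### The generalisation gap as a quadratic polynomial in the path weights. -/

theorem sqLoss_model (wσ : N.Weights) (w : Fin N.dy → N.Path → ℝ) (s : N.Example) :
    sqLoss (N.model wσ w s.1) s.2 =
      ∑ k, ∑ p, ∑ q, w k p * w k q * (N.feature wσ s.1 p * N.feature wσ s.1 q) -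
        2 * ∑ k, ∑ p, w k p * (s.2 k * N.feature wσ s.1 p) + ∑ k, s.2 k ^ 2 := by
  rw [sqLoss, Finset.mul_sum, ← Finset.sum_sub_distrib, ← Finset.sum_add_distrib]
  refine Finset.sum_congr rfl fun k _ => ?_
  have h1 : ∑ p, ∑ q, w k p * w k q * (N.feature wσ s.1 p * N.feature wσ s.1 q) =
      N.model wσ w s.1 k ^ 2 := by
    rw [sq, model, Finset.sum_mul_sum]
    refine Finset.sum_congr rfl fun p _ => Finset.sum_congr rfl fun q _ => ?_
    ring
  have h2 : ∑ p, w k p * (s.2 k * N.feature wσ s.1 p) = s.2 k * N.model wσ w s.1 k := by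
    rw [model, Finset.mul_sum]
    refine Finset.sum_congr rfl fun p _ => ?_
    ring
  rw [h1, h2]
  ring

theorem risk_model (h : N.BoundedVariance P wσ Czz γzz Cyz γyz Cy γy)
    (w : Fin N.dy → N.Path → ℝ) :
    risk P (N.model wσ w) = ∑ k, ∑ p, ∑ q, w k p * w k q *
        (∫ r, N.feature wσ r.1 p * N.feature wσ r.1 q ∂P) -
      2 * ∑ k, ∑ p, w k p * (∫ r, r.2 k * N.feature wσ r.1 p ∂P) +
      ∫ r : N.Example, ∑ k, r.2 k ^ 2 ∂P := by
  have h1 : ∀ k p q, Integrable (fun s : N.Example => w k p * w k q *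
      (N.feature wσ s.1 p * N.feature wσ s.1 q)) P := fun k p q =>
    (h.integrable_feature_mul p q).const_mul _
  have h2 : ∀ k p, Integrable (fun s : N.Example => w k p * (s.2 k * N.feature wσ s.1 p)) P :=
    fun k p => (h.integrable_mul_feature k p).const_mul _
  have h1' : Integrable (fun s : N.Example => ∑ k, ∑ p, ∑ q, w k p * w k q *
      (N.feature wσ s.1 p * N.feature wσ s.1 q)) P :=
    integrable_finsetSum _ fun k _ => integrable_finsetSum _ fun p _ =>
      integrable_finsetSum _ fun q _ => h1 k p q
  have h2' : Integrable (fun s : N.Example =>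
      2 * ∑ k, ∑ p, w k p * (s.2 k * N.feature wσ s.1 p)) P :=
    (integrable_finsetSum _ fun k _ => integrable_finsetSum _ fun p _ => h2 k p).const_mul 2
  simp only [risk, sqLoss_model]
  rw [integral_add (by exact h1'.sub h2') h.integrable_sum_sq, integral_sub h1' h2',
    integral_const_mul]
  congr 3
  · rw [integral_finsetSum _ fun k _ => integrable_finsetSum _ fun p _ =>
      integrable_finsetSum _ fun q _ => h1 k p q]
    refine Finset.sum_congr rfl fun k _ => ?_
    rw [integral_finsetSum _ fun p _ => integrable_finsetSum _ fun q _ => h1 k p q]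
    refine Finset.sum_congr rfl fun p _ => ?_
    rw [integral_finsetSum _ fun q _ => h1 k p q]
    simp only [integral_const_mul]
  · rw [integral_finsetSum _ fun k _ => integrable_finsetSum _ fun p _ => h2 k p]
    refine Finset.sum_congr rfl fun k _ => ?_
    rw [integral_finsetSum _ fun p _ => h2 k p]
    simp only [integral_const_mul]

theorem risk_sub_sqLoss (h : N.BoundedVariance P wσ Czz γzz Cyz γyz Cy γy)
    (w : Fin N.dy → N.Path → ℝ) (s : N.Example) :
    risk P (N.model wσ w) - sqLoss (N.model wσ w s.1) s.2 =
      ∑ k, w k ⬝ᵥ N.devG P wσ s *ᵥ w k + 2 * ∑ k, ∑ p, w k p * N.devV P wσ s k p +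
        N.devY P s := by
  rw [h.risk_model, sqLoss_model]
  simp only [Matrix.dotProduct_mulVec_eq_sum, devG, devV, devY, Matrix.of_apply, mul_sub,
    Finset.sum_sub_distrib]
  ring

/-- Purely deterministic: the hypotheses concern the sample alone, so the conclusion holds for every
`w`, including one fitted to `t`. -/
theorem risk_sub_empRisk_le (h : N.BoundedVariance P wσ Czz γzz Cyz γyz Cy γy)
    (w : Fin N.dy → N.Path → ℝ) (t : κ → N.Example) {b₁ b₂ b₃ : ℝ}
    (h₁ : ∀ v, ∑ i, v ⬝ᵥ N.devG P wσ (t i) *ᵥ v ≤ Fintype.card κ * b₁ * (v ⬝ᵥ v))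
    (h₂ : ∀ k p, |∑ i, N.devV P wσ (t i) k p| ≤ Fintype.card κ * b₂)
    (h₃ : ∑ i, N.devY P (t i) ≤ Fintype.card κ * b₃) :
    risk P (N.model wσ w) - empRisk t (N.model wσ w) ≤
      b₁ * ∑ k, ∑ p, w k p ^ 2 + 2 * b₂ * ∑ k, ∑ p, |w k p| + b₃ := by
  have hM : (0 : ℝ) < Fintype.card κ := by exact_mod_cast Fintype.card_pos
  have e : risk P (N.model wσ w) - empRisk t (N.model wσ w) =
      (∑ k, ∑ i, w k ⬝ᵥ N.devG P wσ (t i) *ᵥ w k +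
        2 * ∑ k, ∑ p, w k p * ∑ i, N.devV P wσ (t i) k p + ∑ i, N.devY P (t i)) /
          Fintype.card κ := by
    have h1 : ∑ i, (risk P (N.model wσ w) - sqLoss (N.model wσ w (t i).1) (t i).2) =
        ∑ k, ∑ i, w k ⬝ᵥ N.devG P wσ (t i) *ᵥ w k +
        2 * ∑ k, ∑ p, w k p * ∑ i, N.devV P wσ (t i) k p + ∑ i, N.devY P (t i) := by
      simp only [h.risk_sub_sqLoss, Finset.sum_add_distrib, ← Finset.mul_sum]
      congr 2
      · exact Finset.sum_comm
      · congr 1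
        rw [Finset.sum_comm]
        refine Finset.sum_congr rfl fun k _ => ?_
        rw [Finset.sum_comm]
        simp only [Finset.mul_sum]
    rw [← h1, Finset.sum_sub_distrib, Finset.sum_const, Finset.card_univ, nsmul_eq_mul, sub_div,
      mul_div_cancel_left₀ _ hM.ne', empRisk]
  rw [e, div_le_iff₀ hM]
  have i1 : ∑ k, ∑ i, w k ⬝ᵥ N.devG P wσ (t i) *ᵥ w k ≤
      Fintype.card κ * b₁ * ∑ k, ∑ p, w k p ^ 2 := by
    rw [Finset.mul_sum]
    refine Finset.sum_le_sum fun k _ => (h₁ (w k)).trans_eq ?_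
    simp [dotProduct, sq]
  have i2 : ∑ k, ∑ p, w k p * ∑ i, N.devV P wσ (t i) k p ≤
      Fintype.card κ * b₂ * ∑ k, ∑ p, |w k p| := by
    simp only [Finset.mul_sum (a := Fintype.card κ * b₂)]
    refine Finset.sum_le_sum fun k _ => Finset.sum_le_sum fun p _ => ?_
    refine (le_abs_self _).trans ?_
    rw [abs_mul, mul_comm]
    exact mul_le_mul_of_nonneg_right (h₂ k p) (abs_nonneg _)
  nlinarith

theorem measure_not_le (h : N.BoundedVariance P wσ Czz γzz Cyz γyz Cy γy) (hδ : 0 < δ)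
    (w : (κ → N.Example) → Fin N.dy → N.Path → ℝ) :
    Measure.pi (fun _ : κ => P) {t | ¬ (risk P (N.model wσ (w t)) - empRisk t (N.model wσ (w t)) ≤
      bernsteinTerm Czz γzz (Fintype.card κ) (3 * N.dz) δ * ∑ k, ∑ p, w t k p ^ 2 +
      2 * bernsteinTerm Cyz γyz (Fintype.card κ) (6 * N.dy * N.dz) δ * ∑ k, ∑ p, |w t k p| +
      bernsteinTerm Cy γy (Fintype.card κ) 3 δ)} ≤ ENNReal.ofReal δ := by
  rcases le_or_gt 1 δ with hδ1 | hδ1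
  -- For `1 ≤ δ` there is nothing to prove; the tail bounds need `δ < 1`.
  · exact prob_le_one.trans (by simpa using ENNReal.ofReal_le_ofReal hδ1)
  -- The three bad events do not mention `w`. Monotonicity of the outer measure makes measurability
  -- of `w` unnecessary.
  refine (measure_mono (t := ({t : κ → N.Example | ∃ v, Fintype.card κ *
      bernsteinTerm Czz γzz (Fintype.card κ) (3 * N.dz) δ * (v ⬝ᵥ v) <
        ∑ i, v ⬝ᵥ N.devG P wσ (t i) *ᵥ v} ∪ {t : κ → N.Example | ∃ k p, Fintype.card κ *
      bernsteinTerm Cyz γyz (Fintype.card κ) (6 * N.dy * N.dz) δ <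
        |∑ i, N.devV P wσ (t i) k p|}) ∪ {t : κ → N.Example | Fintype.card κ *
      bernsteinTerm Cy γy (Fintype.card κ) 3 δ < ∑ i, N.devY P (t i)}) fun t ht => ?_).trans ?_
  · contrapose! ht
    simp only [Set.mem_union, Set.mem_ofPred_eq, not_or, not_exists, not_lt] at ht
    simp only [Set.mem_ofPred_eq, not_lt]
    exact h.risk_sub_empRisk_le (w t) t ht.1.1 ht.1.2 ht.2
  · refine (measure_union_le _ _).trans ((add_le_add (measure_union_le _ _) le_rfl).trans ?_)
    refine (add_le_add (add_le_add (h.measure_devG_le hδ hδ1) (h.measure_devV_le hδ hδ1))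
      (h.measure_devY_le hδ hδ1)).trans_eq ?_
    rw [← ENNReal.ofReal_add (by positivity) (by positivity),
      ← ENNReal.ofReal_add (by positivity) (by positivity)]
    congr 1
    ring

end BoundedVariance

end Architecture
-- The bound conditional on the first part of the data.
theorem mainTheorem2
    -- a ReLU / max-pooling network and the true distribution of `(x, y)`
    (N : Architecture) (P : Measure N.Example) [IsProbabilityMeasure P]
    -- a dataset `S` of size `m`, whose first part `S_{αm}` has `n = αm` examples
    (m n : ℕ) (α : ℝ) (hm : 0 < m) (hα : α ∈ Set.Ioo (0 : ℝ) 1) (hn : (n : ℝ) = α * m)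
    {Ω : Type*} [MeasurableSpace Ω] (μ : Measure Ω) [IsProbabilityMeasure μ]
    (S : Fin m → Ω → N.Example) (hS : ∀ i, Measurable (S i))
    -- the second part is i.i.d. with law `P` and independent of the first part
    (hlaw : ∀ i : {i : Fin m // n ≤ i.val}, μ.map (S i) = P)
    (hiid : iIndepFun (fun i : {i : Fin m // n ≤ i.val} => S i) μ)
    (hindep : IndepFun (fun ω (i : {i : Fin m // i.val < n}) => S i ω)
      (fun ω (i : {i : Fin m // n ≤ i.val}) => S i ω) μ)
    -- standard phase: learns `w_σ` from `S_{αm}`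
    (phase₁ : ({i : Fin m // i.val < n} → N.Example) → N.Weights)
    -- freeze phase: learns the vectors `w̄_k` from all of `S`; for a network that is trained through
    -- its weights `w`, this is `N.pathWeight w`
    (phase₂ : (Fin m → N.Example) → Fin N.dy → N.Path → ℝ) :
    -- for (almost) every value `s` of `S_{αm}`, conditionally on `S_{αm} = s`
    ∀ᵐ s ∂(μ.map fun ω (i : {i : Fin m // i.val < n}) => S i ω),
      ∀ Czz γzz Cyz γyz Cy γy : ℝ,
        N.BoundedVariance P (phase₁ s) Czz γzz Cyz γyz Cy γy →
        ∀ δ : ℝ, 0 < δ →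
          -- the bound fails with probability at most `δ`
          condDistrib (fun ω (i : {i : Fin m // n ≤ i.val}) => S i ω)
              (fun ω (i : {i : Fin m // i.val < n}) => S i ω) μ s
            {t | ¬ (risk P (N.model (phase₁ s) (phase₂ (joinData s t))) -
                  empRisk t (N.model (phase₁ s) (phase₂ (joinData s t))) ≤
                bernsteinTerm Czz γzz ((1 - α) * m) (3 * N.dz) δ *
                    ∑ k, ∑ p, phase₂ (joinData s t) k p ^ 2 +
                  2 * bernsteinTerm Cyz γyz ((1 - α) * m) (6 * N.dy * N.dz) δ *
                    ∑ k, ∑ p, |phase₂ (joinData s t) k p| +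
                  bernsteinTerm Cy γy ((1 - α) * m) 3 δ)}
            ≤ ENNReal.ofReal δ := by

  have hmpos : (0 : ℝ) < m := by exact_mod_cast hm
  have hnm : n < m := by
    have : (n : ℝ) < m := by rw [hn]; nlinarith [hα.2]
    exact_mod_cast this
  -- `α < 1` leaves at least one example for the second part.
  have : Nonempty {i : Fin m // n ≤ i.val} := ⟨⟨⟨n, hnm⟩, le_rfl⟩⟩
  have hcard : (Fintype.card {i : Fin m // n ≤ i.val} : ℝ) = (1 - α) * m := by
    have h1 := Fintype.card_subtype_compl fun i : Fin m => i.val < n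
    have h2 : Fintype.card {i : Fin m // i.val < n} = n := by
      rw [Fintype.card_subtype]
      simp [Fin.card_filter_val_lt, hnm.le]
    simp only [not_lt, h2, Fintype.card_fin] at h1
    rw [h1, Nat.cast_sub hnm.le, hn]
    ring
  have hlaw' : μ.map (fun ω (i : {i : Fin m // n ≤ i.val}) => S i ω) =
      Measure.pi fun _ => P := by
    rw [(iIndepFun_iff_map_fun_eq_pi_map fun i : {i : Fin m // n ≤ i.val} =>
      (hS i).aemeasurable).1 hiid]
    simp only [hlaw]
  have hcond := hindep.condDistrib_ae_eq (measurable_pi_lambda _ fun i => hS i)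
    (measurable_pi_lambda _ fun i => hS i)
  -- The exceptional null set comes from `hcond` alone, so one set serves all constants and all `δ`.
  filter_upwards [hcond] with s hs Czz γzz Cyz γyz Cy γy hB δ hδ
  rw [hs, hlaw', ← hcard]
  exact hB.measure_not_le hδ fun t => phase₂ (joinData s t)
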